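/- **Conventions.** All groups are discrete. For a group $G$ acting by linear operators of norm $\le 1$ on a real normed space $V$, $C_b^n(G,V)$ is the space of bounded maps $G^n\to V$ with the differential $$df(g_1,\dots,g_{n+1})=g_1f(g_2,\dots,g_{n+1})+\sum_{j=1}^{n}(-1)^jf(\dots,g_jg_{j+1},\dots)+(-1)^{n+1}f(g_1,\dots,g_n),$$ and $H_b^n(G,V)$ is its cohomology (bounded cohomology). *Reduced $\ell^1$-homology.* $C_n^{\ell_1}(G)=\ell^1(G^n)$ carries the bounded boundary operator with $\partial[g_1|\cdots|g_n]=[g_2|\cdots|g_n]+\sum_{j=1}^{n-1}(-1)^j[\cdots|g_jg_{j+1}|\cdots]+(-1)^n[g_1|\cdots|g_{n-1}]$, and $\overline H_2(G):=\overline H_2^{\ell_1}(G,\mathbb R)=\ker\partial_2/\overline{\operatorname{im}\partial_3}$, with the quotient norm. The group $\mathrm{Aut}(G)$ acts on $\overline H_2(G)$ by isometries and inner automorphisms act trivially, so that $\mathrm{Out}(G)=\mathrm{Aut}(G)/\mathrm{Inn}(G)$ acts on $\overline H_2(G)$. *The class $\mathbf g_2$.* Put $\mathbf m(g)=\sum_{n\ge1}2^{-n}[g^{2^{n-1}}|g^{2^{n-1}}]$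 and $\mathbf m_2(g,h)=[g|h]-\mathbf m(g)+\mathbf m(gh)-\mathbf m(h)$. Then $\mathbf m_2(g,h)$ is a cycle; its class $\overline{\mathbf m}_2(g,h)\in\overline H_2(G)$ defines a bounded $2$-cocycle on $G$ with values in the trivial $G$-module $\overline H_2(G)$. Let $\mathbf g_2=[\overline{\mathbf m}_2]\in H_b^2(G,\overline H_2(G))$. *The class $[\theta]$.* Let $1\to G\xrightarrow{i}\Gamma\xrightarrow{\sigma}\Pi\to1$ be an extension of groups, and let $\theta:\Pi\to\mathrm{Out}(G)$ be its outer action: $\theta(\sigma(\gamma))$ is the class of conjugation by $\gamma$ on $G$. Through $\theta$, the space $V:=\overline H_2(G)$ is a $\Pi$-module, and, through $\sigma$, a $\Gamma$-module on which $G$ acts trivially. An abstract kernel of $\theta$ is a pair of maps $\Psi:\Pi\to\mathrm{Aut}(G)$, $f:\Pi^2\to G$ such that $\Psi(\alpha)$ represents $\theta(\alpha)$ and $\Psi(\alpha)\Psi(\beta)=\mathrm{conj}_{f(\alpha,\beta)}\Psi(\alpha\beta)$, where $\mathrm{conj}_t(x)=txt^{-1}$; such pairs exist. Put $$\overline\theta_{\Psi,f}(\alpha,\beta,\gamma)=\overline{\mathbf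 m}_2\bigl(\Psi(\alpha)(f(\beta,\gamma)),f(\alpha,\beta\gamma)\bigr)-\overline{\mathbf m}_2\bigl(f(\alpha,\beta),f(\alpha\beta,\gamma)\bigr).$$ *The Hochschild–Serre spectral sequence.* Let $U^q$ be the space of bounded maps $u:\Gamma^{q+1}\to V$ with $u(gx_0,\dots,gx_q)=u(x_0,\dots,x_q)$ for $g\in G$. It has the $\Pi$-action induced by $(\gamma u)(x)=\gamma\,u(\gamma^{-1}x)$, $\gamma\in\Gamma$, and the homogeneous coboundary $U^q\to U^{q+1}$, $u\mapsto\sum_i(-1)^iu(\dots,\widehat{x_i},\dots)$. Let $K^{p,q}=C_b^p(\Pi,U^q)$ $(p,q\ge0)$, with the differential $d_\Pi$ of $C_b^*(\Pi,U^q)$ and the differential $d_U$ induced by $U^q\to U^{q+1}$. Its total complex $\mathrm{Tot}^n=\bigoplus_{p+q=n}K^{p,q}$, with $D=d_\Pi+(-1)^pd_U$ on $K^{p,q}$, is filtered by $F^p\mathrm{Tot}=\bigoplus_{i\ge p}K^{i,j}$. Put $$Z_r^{p,q}=\{x\in F^p\mathrm{Tot}^{p+q}: Dx\in F^{p+r}\mathrm{Tot}^{p+q+1}\},\qquad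 B_r^{p,q}=F^p\mathrm{Tot}^{p+q}\cap D(F^{p-r}\mathrm{Tot}^{p+q-1}),$$ $$E_r^{p,q}=Z_r^{p,q}/(Z_{r-1}^{p+1,q-1}+B_{r-1}^{p,q}),\qquad d_r:E_r^{p,q}\to E_r^{p+r,q-r+1},\quad d_r[x]=[Dx].$$ **Theorem.** With these notations: 1. Sending $x$ to the restriction to $G$ of its component in $K^{0,2}=U^2$, that is, to the cochain $(g_1,g_2)\mapsto x^{0,2}(1,g_1,g_1g_2)$, induces an isomorphism of vector spaces of $E_3^{0,2}$ onto the space $H_b^2(G,\overline H_2(G))^\Pi$ of invariant classes, where $\gamma\in\Gamma$ acts by $(\gamma c)(g_1,g_2)=\gamma\,c(\gamma^{-1}g_1\gamma,\gamma^{-1}g_2\gamma)$. Viewing $\overline H_2(G)$ as the constant functions in $U^0$ induces an isomorphism of vector spaces $H_b^3(\Pi,\overline H_2(G))\to E_3^{3,0}$. 2. The class $\mathbf g_2$ is $\Pi$-invariant, hence an element of $E_3^{0,2}$. For every abstract kernel $(\Psi,f)$ of $\theta$ the cochain $\overline\theta_{\Psi,f}$ is a bounded $3$-cocycle on $\Pi$,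 and its class $[\theta]\in H_b^3(\Pi,\overline H_2(G))\cong E_3^{3,0}$ does not depend on $(\Psi,f)$. 3. The differential $d_3:E_3^{0,2}\to E_3^{3,0}$ maps $\mathbf g_2$ to $[\theta]$: $$d_3(\mathbf g_2)=[\theta].$$ -/

import Mathlib

open scoped ENNReal

namespace BddCoh

/-! ### Normed modules over a group -/

/-- A linear action of a group `G` on a normed space `V` by operators of norm at most `1`. -/
structure NormedGModule (G : Type*) [Group G] (V : Type*) [NormedAddCommGroup V]
    [NormedSpace ℝ V] where
  /-- the underlying linear representation -/
  rep : Representation ℝ G V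
  norm_rep_le : ∀ g v, ‖rep g v‖ ≤ ‖v‖

namespace NormedGModule

variable {G : Type*} [Group G] {H : Type*} [Group H] {V : Type*} [NormedAddCommGroup V]
  [NormedSpace ℝ V]

/-- The trivial module structure. -/
def trivial (G : Type*) [Group G] (V : Type*) [NormedAddCommGroup V] [NormedSpace ℝ V] :
    NormedGModule G V where
  rep := 1
  norm_rep_le _ _ := le_rfl

/-- Pull-back of a module structure along a homomorphism. -/
def comp (M : NormedGModule H V) (φ : G →* H) : NormedGModule G V where
  rep := M.rep.comp φ
  norm_rep_le g v := M.norm_rep_le (φ g) v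

theorem rep_mul (M : NormedGModule G V) (a b : G) (v : V) :
    M.rep (a * b) v = M.rep a (M.rep b v) := by
  rw [map_mul]; rfl

theorem rep_one (M : NormedGModule G V) (v : V) : M.rep 1 v = v := by
  rw [map_one]; rfl

/-- If `σ : G → H` is surjective and `ker σ` acts trivially on `V`, then the action of `G`
descends to an action of `H`, with `σ g` acting as `g`. -/
noncomputable def descend (M : NormedGModule G V) (σ : G →* H) (hσ : Function.Surjective σ)
    (h : ∀ g, σ g = 1 → M.rep g = 1) : NormedGModule H V where
  rep :=
    { toFun := fun a => M.rep (Function.surjInv hσ a)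
      map_one' := h _ (Function.surjInv_eq hσ 1)
      map_mul' := fun a b => by
        have key : ∀ x y : G, σ x = σ y → M.rep x = M.rep y := fun x y hxy => by
          have h1 := h (x * y⁻¹) (by rw [map_mul, map_inv, hxy, mul_inv_cancel])
          calc M.rep x = M.rep (x * y⁻¹) * M.rep y := by rw [← map_mul]; simp
            _ = M.rep y := by rw [h1, one_mul]
        rw [← map_mul]
        have hs : ∀ c, σ (Function.surjInv hσ c) = c := Function.surjInv_eq hσ
        exact key _ _ (by rw [map_mul, hs, hs, hs]) }
  norm_rep_le _ v := M.norm_rep_le _ v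

theorem descend_rep (M : NormedGModule G V) (σ : G →* H) (hσ : Function.Surjective σ)
    (h : ∀ g, σ g = 1 → M.rep g = 1) (g : G) : (M.descend σ hσ h).rep (σ g) = M.rep g := by
  have h1 := h (Function.surjInv hσ (σ g) * g⁻¹)
    (by rw [map_mul, map_inv, Function.surjInv_eq hσ, mul_inv_cancel])
  calc M.rep (Function.surjInv hσ (σ g))
      = M.rep (Function.surjInv hσ (σ g) * g⁻¹) * M.rep g := by rw [← map_mul]; simp
    _ = M.rep g := by rw [h1, one_mul]

end NormedGModule

/-! ### Bounded functions -/

section bounded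

variable {S : Type*} {V W : Type*} [NormedAddCommGroup V] [NormedAddCommGroup W]

/-- The normed space of bounded functions `S → V` with the supremum norm. -/
abbrev Bdd (S : Type*) (V : Type*) [NormedAddCommGroup V] := lp (fun _ : S => V) ∞

/-- A bounded function, given with a bound. -/
def Bdd.mk (f : S → V) (h : ∃ C, ∀ s, ‖f s‖ ≤ C) : Bdd S V :=
  ⟨f, memℓp_infty (by obtain ⟨C, hC⟩ := h; exact ⟨C, by rintro _ ⟨s, rfl⟩; exact hC s⟩)⟩

@[simp] theorem Bdd.mk_apply (f : S → V) (h : ∃ C, ∀ s, ‖f s‖ ≤ C) (s : S) :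
    Bdd.mk f h s = f s := rfl

theorem bdd_norm_le (f : Bdd S V) (s : S) : ‖f s‖ ≤ ‖f‖ :=
  lp.norm_apply_le_norm ENNReal.top_ne_zero f s

variable [NormedSpace ℝ V] [NormedSpace ℝ W]

/-- Composition of a bounded function with a continuous linear map. -/
noncomputable def Bdd.map (φ : V →L[ℝ] W) : Bdd S V →ₗ[ℝ] Bdd S W where
  toFun f := Bdd.mk (fun s => φ (f s)) ⟨‖φ‖ * ‖f‖, fun s =>
    (φ.le_opNorm _).trans (mul_le_mul_of_nonneg_left (bdd_norm_le f s) (norm_nonneg _))⟩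
  map_add' f g := by ext s; simp
  map_smul' c f := by ext s; simp

@[simp] theorem Bdd.map_apply (φ : V →L[ℝ] W) (f : Bdd S V) (s : S) :
    Bdd.map φ f s = φ (f s) := rfl

end bounded

/-! ### Bounded cohomology of a discrete group -/

section cohomology

variable {G : Type*} [Group G] {V : Type*} [NormedAddCommGroup V] [NormedSpace ℝ V]

/-- The homogeneous coboundary of a function of `n + 1` variables. -/
def homDelta {X : Type*} {n : ℕ} (F : (Fin (n + 1) → X) → V) (x : Fin (n + 2) → X) : V :=
  ∑ i : Fin (n + 2), (-1 : ℝ) ^ (i : ℕ) • F (x ∘ i.succAbove)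

theorem homDelta_homDelta {X : Type*} {n : ℕ} (F : (Fin (n + 1) → X) → V) (x : Fin (n + 3) → X) :
    homDelta (homDelta F) x = 0 := by
  simp only [homDelta, Finset.smul_sum, Fin.sum_sum_eq_sum_triangle_add]
  refine Finset.sum_eq_zero fun i _ => Finset.sum_eq_zero fun j hj => ?_
  rw [Finset.mem_Ici] at hj
  have h : (x ∘ (i.castSucc).succAbove) ∘ j.succAbove = (x ∘ (j.succ).succAbove) ∘ i.succAbove := by
    funext k
    have h1 : (i.castSucc).succAbove (j.succAbove k) = (j.succ).succAbove (i.succAbove k) := by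
      rw [Fin.le_def] at hj
      ext
      simp only [Fin.succAbove, Fin.lt_def]
      split_ifs <;> simp_all <;> omega
    simp only [Function.comp_apply, h1]
  rw [h]
  simp only [Fin.val_castSucc, Fin.val_succ, smul_smul]
  rw [← add_smul]
  ring_nf
  simp

/-- The inhomogeneous coboundary
`(d f)(g₁, …, gₙ₊₁) = g₁ f(g₂, …, gₙ₊₁) + ∑ⱼ (-1)ʲ f(…, gⱼ gⱼ₊₁, …) + (-1)ⁿ⁺¹ f(g₁, …, gₙ)`;
`Fin.contractNth (Fin.last n)` drops the last entry. -/
def dFun (M : NormedGModule G V) {n : ℕ} (f : (Fin n → G) → V) (g : Fin (n + 1) → G) : V :=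
  M.rep (g 0) (f fun i => g i.succ) +
    ∑ j : Fin (n + 1), (-1 : ℝ) ^ ((j : ℕ) + 1) • f (j.contractNth (· * ·) g)

/-- The homogeneous function attached to an inhomogeneous one. -/
def homog (M : NormedGModule G V) {n : ℕ} (f : (Fin n → G) → V) (x : Fin (n + 1) → G) : V :=
  M.rep (x 0) (f fun i => (x i.castSucc)⁻¹ * x i.succ)

theorem homog_smul (M : NormedGModule G V) {n : ℕ} (f : (Fin n → G) → V) (a : G)
    (x : Fin (n + 1) → G) : homog M f (fun i => a * x i) = M.rep a (homog M f x) := by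
  simp only [homog, M.rep_mul]
  congr 3
  funext i
  group

theorem homog_partialProd (M : NormedGModule G V) {n : ℕ} (f : (Fin n → G) → V)
    (g : Fin n → G) : homog M f (Fin.partialProd g) = f g := by
  simp only [homog, Fin.partialProd_zero, M.rep_one, Fin.partialProd_right_inv]

theorem homDelta_homog_partialProd (M : NormedGModule G V) {n : ℕ} (f : (Fin n → G) → V)
    (g : Fin (n + 1) → G) : homDelta (homog M f) (Fin.partialProd g) = dFun M f g := by
  rw [homDelta, Fin.sum_univ_succ, dFun]
  congr 1
  · have : (Fin.partialProd g ∘ (0 : Fin (n + 2)).succAbove) =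
        fun i => g 0 * Fin.partialProd (Fin.tail g) i := by
      funext i
      simp [Fin.partialProd_succ']
    rw [this, homog_smul, homog_partialProd]
    simp [Fin.tail_def]
  · refine Finset.sum_congr rfl fun j _ => ?_
    rw [← Fin.partialProd_contractNth, homog_partialProd, Fin.val_succ]

theorem homog_dFun (M : NormedGModule G V) {n : ℕ} (f : (Fin n → G) → V) :
    homog M (dFun M f) = homDelta (homog M f) := by
  funext x
  have hx := Fin.partialProd_left_inv x
  have h2 : x = fun i => x 0 * Fin.partialProd (fun i : Fin (n + 1) => (x i.castSucc)⁻¹ * x i.succ) i :=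
    hx.symm
  conv_rhs => rw [h2]
  have : ∀ (a : G) (y : Fin (n + 2) → G),
      homDelta (homog M f) (fun i => a * y i) = M.rep a (homDelta (homog M f) y) := by
    intro a y
    simp only [homDelta, map_sum, map_smul]
    refine Finset.sum_congr rfl fun i _ => ?_
    rw [← homog_smul]; rfl
  rw [this, homDelta_homog_partialProd]
  rfl

theorem dFun_dFun (M : NormedGModule G V) {n : ℕ} (f : (Fin n → G) → V) (g : Fin (n + 2) → G) :
    dFun M (dFun M f) g = 0 := by
  rw [← homDelta_homog_partialProd, homog_dFun, homDelta_homDelta]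

/-- The bounded inhomogeneous `n`-cochains `Gⁿ → V`. -/
abbrev BCochain (n : ℕ) (G : Type*) (V : Type*) [NormedAddCommGroup V] := Bdd (Fin n → G) V

theorem norm_neg_one_pow_smul (k : ℕ) (v : V) : ‖(-1 : ℝ) ^ k • v‖ = ‖v‖ := by
  rw [norm_smul]; simp

/-- The coboundary on bounded cochains. -/
noncomputable def d (M : NormedGModule G V) (n : ℕ) :
    BCochain n G V →ₗ[ℝ] BCochain (n + 1) G V where
  toFun f := Bdd.mk (dFun M f) ⟨‖f‖ + ∑ _j : Fin (n + 1), ‖f‖, fun g => by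
    refine (norm_add_le _ _).trans (add_le_add ((M.norm_rep_le _ _).trans (bdd_norm_le f _)) ?_)
    refine (norm_sum_le _ _).trans (Finset.sum_le_sum fun j _ => ?_)
    rw [norm_neg_one_pow_smul]
    exact bdd_norm_le f _⟩
  map_add' f g := by
    ext x
    simp only [Bdd.mk_apply, dFun, lp.coeFn_add, Pi.add_apply, map_add, smul_add,
      Finset.sum_add_distrib]
    abel
  map_smul' c f := by
    ext x
    simp only [Bdd.mk_apply, dFun, lp.coeFn_smul, Pi.smul_apply, map_smul, smul_add,
      Finset.smul_sum, RingHom.id_apply, smul_comm c]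

theorem d_apply (M : NormedGModule G V) (n : ℕ) (f : BCochain n G V) (g : Fin (n + 1) → G) :
    d M n f g = dFun M f g := rfl

theorem d_d (M : NormedGModule G V) (n : ℕ) (f : BCochain n G V) : d M (n + 1) (d M n f) = 0 := by
  ext g
  exact dFun_dFun M f g

/-- Bounded cocycles. -/
noncomputable def cocycles (M : NormedGModule G V) (n : ℕ) : Submodule ℝ (BCochain n G V) :=
  LinearMap.ker (d M n)

/-- Coboundaries of bounded cochains (there are none in degree zero). -/
noncomputable def coboundaries (M : NormedGModule G V) :
    (n : ℕ) → Submodule ℝ (BCochain n G V)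
  | 0 => ⊥
  | n + 1 => LinearMap.range (d M n)

/-- The bounded cohomology space `H_bⁿ(G, V)`. -/
abbrev HB (M : NormedGModule G V) (n : ℕ) : Type _ :=
  cocycles M n ⧸ (coboundaries M n).submoduleOf (cocycles M n)

/-- The bounded cohomology class of a bounded cocycle. -/
noncomputable def HB.mk (M : NormedGModule G V) (n : ℕ) (c : BCochain n G V)
    (h : c ∈ cocycles M n) : HB M n :=
  Submodule.Quotient.mk ⟨c, h⟩

end cohomology

/-! ### Reduced `ℓ¹`-homology of a discrete group in degree two -/

section ellOne

/-- The Banach space `ℓ¹(S)`, completion of the space `ℝ[S]` for the `ℓ¹`-norm. -/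
abbrev L1 (S : Type*) := lp (fun _ : S => ℝ) 1

/-- The basis vector of `ℓ¹(S)` attached to `s`. -/
noncomputable def L1.basis {S : Type*} (s : S) : L1 S := by
  classical exact lp.single 1 s 1

theorem L1.norm_basis {S : Type*} (s : S) : ‖L1.basis s‖ = 1 := by
  classical
  have := lp.norm_single (E := fun _ : S => ℝ) (p := 1) one_pos s 1
  simp only [norm_one] at this
  rw [← this, L1.basis]

theorem L1.summable_norm {S : Type*} (z : L1 S) : Summable fun s => ‖z s‖ := by
  have := (lp.memℓp z).summable (by simp)
  simpa using this

theorem L1.norm_eq {S : Type*} (z : L1 S) : ‖z‖ = ∑' s, ‖z s‖ := by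
  have := lp.norm_eq_tsum_rpow (p := 1) (by simp) z
  simpa using this

variable {E : Type*} [NormedAddCommGroup E] [NormedSpace ℝ E]

theorem L1.summable_smul {S : Type*} (f : Bdd S E) (z : L1 S) :
    Summable fun s => ‖z s • f s‖ := by
  refine Summable.of_nonneg_of_le (fun _ => norm_nonneg _) (fun s => ?_)
    ((L1.summable_norm z).mul_right ‖f‖)
  rw [norm_smul]
  exact mul_le_mul_of_nonneg_left (bdd_norm_le f s) (norm_nonneg _)

theorem L1.hom_ext {S : Type*} {φ ψ : L1 S →L[ℝ] E} (h : ∀ s, φ (L1.basis s) = ψ (L1.basis s)) :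
    φ = ψ := by
  classical
  refine lp.ext_continuousLinearMap (by simp) fun s => ?_
  have hb : L1.basis s = lp.single (E := fun _ : S => ℝ) 1 s 1 := by rw [L1.basis]
  ext
  have := h s
  rw [hb] at this
  simpa using this

variable [CompleteSpace E]

/-- The continuous linear map `ℓ¹(S) → E` which extends a bounded function `f : S → E`. -/
noncomputable def L1.lift {S : Type*} (f : Bdd S E) : L1 S →L[ℝ] E :=
  LinearMap.mkContinuous
    { toFun := fun z => ∑' s, z s • f s
      map_add' := fun z w => by
        rw [← ((L1.summable_smul f z).of_norm).tsum_add ((L1.summable_smul f w).of_norm)]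
        simp [add_smul]
      map_smul' := fun c z => by
        rw [RingHom.id_apply, ← ((L1.summable_smul f z).of_norm).tsum_const_smul]
        simp [mul_smul] }
    ‖f‖ (fun z => by
      refine (norm_tsum_le_tsum_norm (L1.summable_smul f z)).trans ?_
      rw [L1.norm_eq, ← tsum_mul_left]
      refine (L1.summable_smul f z).tsum_le_tsum (fun s => ?_)
        ((L1.summable_norm z).mul_left _)
      rw [norm_smul, mul_comm]
      exact mul_le_mul_of_nonneg_right (bdd_norm_le f s) (norm_nonneg _))

theorem L1.norm_lift_le {S : Type*} (f : Bdd S E) : ‖L1.lift f‖ ≤ ‖f‖ :=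
  LinearMap.mkContinuous_norm_le _ (norm_nonneg f) _

@[simp] theorem L1.lift_basis {S : Type*} (f : Bdd S E) (s : S) :
    L1.lift f (L1.basis s) = f s := by
  classical
  change ∑' t, (L1.basis s) t • f t = f s
  have hb : L1.basis s = lp.single (E := fun _ : S => ℝ) 1 s 1 := by rw [L1.basis]
  rw [tsum_eq_single s, hb]
  · simp
  · intro t ht
    rw [hb, lp.single_apply_ne (E := fun _ : S => ℝ) 1 s 1 ht, zero_smul]

/-- The map `ℓ¹(S) → ℓ¹(T)` induced by a map `S → T`. -/
noncomputable def L1.push {S T : Type*} (φ : S → T) : L1 S →L[ℝ] L1 T :=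
  L1.lift (Bdd.mk (fun s => L1.basis (φ s)) ⟨1, fun _ => (L1.norm_basis _).le⟩)

@[simp] theorem L1.push_basis {S T : Type*} (φ : S → T) (s : S) :
    L1.push φ (L1.basis s) = L1.basis (φ s) := by
  simp [L1.push]

theorem L1.norm_push_le {S T : Type*} (φ : S → T) (z : L1 S) : ‖L1.push φ z‖ ≤ ‖z‖ := by
  have h1 : ‖L1.push φ‖ ≤ 1 := (L1.norm_lift_le _).trans
    (lp.norm_le_of_forall_le zero_le_one fun _ => (L1.norm_basis _).le)
  simpa using (L1.push φ).le_of_opNorm_le h1 z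

variable (G : Type*) [Group G]

/-- The boundary `∂[g₁|…|gₙ₊₁] = [g₂|…|gₙ₊₁] + ∑ⱼ (-1)ʲ [g₁|…|gⱼgⱼ₊₁|…|gₙ₊₁] +
(-1)ⁿ⁺¹ [g₁|…|gₙ]` on `ℓ¹`-chains with real coefficients. -/
noncomputable def bd (n : ℕ) : L1 (Fin (n + 1) → G) →L[ℝ] L1 (Fin n → G) :=
  L1.push Fin.tail +
    ∑ j : Fin (n + 1), (-1 : ℝ) ^ ((j : ℕ) + 1) • L1.push (Fin.contractNth j (· * ·))

theorem bd_basis (n : ℕ) (g : Fin (n + 1) → G) :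
    bd G n (L1.basis g) = L1.basis (Fin.tail g) +
      ∑ j : Fin (n + 1), (-1 : ℝ) ^ ((j : ℕ) + 1) • L1.basis (Fin.contractNth j (· * ·) g) := by
  simp [bd]

theorem bd_basis_two (g h : G) : bd G 1 (L1.basis ![g, h]) =
    L1.basis ![h] - L1.basis ![g * h] + L1.basis ![g] := by
  have h0 : Fin.tail ![g, h] = ![h] := by ext i; fin_cases i; rfl
  have h1 : Fin.contractNth 0 (· * ·) ![g, h] = ![g * h] := by ext i; fin_cases i; rfl
  have h2 : Fin.contractNth 1 (· * ·) ![g, h] = ![g] := by ext i; fin_cases i; rfl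
  rw [bd_basis, Fin.sum_univ_two, h0, h1, h2]
  simp [sub_eq_add_neg, add_assoc]

theorem bd_basis_three (g h k : G) : bd G 2 (L1.basis ![g, h, k]) =
    L1.basis ![h, k] - L1.basis ![g * h, k] + L1.basis ![g, h * k] - L1.basis ![g, h] := by
  have h0 : Fin.tail ![g, h, k] = ![h, k] := by ext i; fin_cases i <;> rfl
  have h1 : Fin.contractNth 0 (· * ·) ![g, h, k] = ![g * h, k] := by
    ext i; fin_cases i <;> rfl
  have h2 : Fin.contractNth 1 (· * ·) ![g, h, k] = ![g, h * k] := by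
    ext i; fin_cases i <;> rfl
  have h3 : Fin.contractNth 2 (· * ·) ![g, h, k] = ![g, h] := by ext i; fin_cases i <;> rfl
  have h4 : (-1 : ℝ) ^ 3 = -1 := by norm_num
  rw [bd_basis, Fin.sum_univ_three, h0, h1, h2, h3]
  simp [sub_eq_add_neg, add_assoc, h4]

/-- The space of `ℓ¹`-cycles of degree two. -/
noncomputable def Z2 : Submodule ℝ (L1 (Fin 2 → G)) := LinearMap.ker (bd G 1).toLinearMap

/-- The closure of the space of `ℓ¹`-boundaries of degree two, as a subspace of `Z2 G`. -/
noncomputable def B2closure : Submodule ℝ (Z2 G) :=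
  (LinearMap.range (bd G 2).toLinearMap).topologicalClosure.submoduleOf (Z2 G)

instance isClosed_B2closure : IsClosed (B2closure G : Set (Z2 G)) :=
  (Submodule.isClosed_topologicalClosure _).preimage continuous_subtype_val

instance completeSpace_Z2 : CompleteSpace (Z2 G) :=
  ((bd G 1).isClosed_ker).completeSpace_coe

/-- The reduced `ℓ¹`-homology space of degree two with real coefficients: the quotient of the
cycles by the closure of the boundaries, i.e. the quotient of the `ℓ¹`-homology space by the
kernel of its seminorm.  It carries the quotient norm. -/
def RedH2 : Type _ := Z2 G ⧸ B2closure G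

noncomputable instance normedAddCommGroup_redH2 : NormedAddCommGroup (RedH2 G) :=
  inferInstanceAs (NormedAddCommGroup (Z2 G ⧸ B2closure G))

noncomputable instance normedSpace_redH2 : NormedSpace ℝ (RedH2 G) :=
  inferInstanceAs (NormedSpace ℝ (Z2 G ⧸ B2closure G))

/-- The reduced homology class of an `ℓ¹`-cycle. -/
noncomputable def RedH2.mk : Z2 G →ₗ[ℝ] RedH2 G := (B2closure G).mkQ

theorem RedH2.mk_eq_zero {z : Z2 G} : RedH2.mk G z = 0 ↔ z ∈ B2closure G :=
  Submodule.Quotient.mk_eq_zero (B2closure G)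

theorem RedH2.norm_mk_le (z : Z2 G) : ‖RedH2.mk G z‖ ≤ ‖z‖ :=
  Submodule.Quotient.norm_mk_le (B2closure G) z

theorem RedH2.hom_ext {φ ψ : RedH2 G →ₗ[ℝ] RedH2 G}
    (h : ∀ z, φ (RedH2.mk G z) = ψ (RedH2.mk G z)) : φ = ψ := by
  refine LinearMap.ext fun x => ?_
  obtain ⟨z, rfl⟩ := (B2closure G).mkQ_surjective x
  exact h z

variable {G}

/-- The map on `n`-chains induced by an automorphism. -/
noncomputable def chainMap (ψ : MulAut G) (n : ℕ) : L1 (Fin n → G) →L[ℝ] L1 (Fin n → G) :=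
  L1.push fun g i => ψ (g i)

theorem chainMap_basis (ψ : MulAut G) (n : ℕ) (g : Fin n → G) :
    chainMap ψ n (L1.basis g) = L1.basis fun i => ψ (g i) := L1.push_basis _ _

theorem bd_chainMap (ψ : MulAut G) (n : ℕ) (z : L1 (Fin (n + 1) → G)) :
    bd G n (chainMap ψ (n + 1) z) = chainMap ψ n (bd G n z) := by
  have : (bd G n).comp (chainMap ψ (n + 1)) = (chainMap ψ n).comp (bd G n) := by
    refine L1.hom_ext fun g => ?_
    simp only [ContinuousLinearMap.comp_apply, chainMap_basis, bd_basis, map_add, map_sum, map_smul]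
    congr 1
    refine Finset.sum_congr rfl fun j _ => ?_
    congr 2
    exact (Fin.comp_contractNth (· * ·) (· * ·) (f := ψ) (map_mul ψ) j g).symm
  exact DFunLike.congr_fun this z

theorem chainMap_one (n : ℕ) : chainMap (1 : MulAut G) n = ContinuousLinearMap.id ℝ _ :=
  L1.hom_ext fun g => by simp [chainMap_basis]

theorem chainMap_mul (φ ψ : MulAut G) (n : ℕ) :
    chainMap (φ * ψ) n = (chainMap φ n).comp (chainMap ψ n) :=
  L1.hom_ext fun g => by simp [chainMap_basis]

/-- The map on cycles induced by an automorphism. -/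
noncomputable def cycleMap (ψ : MulAut G) : Z2 G →ₗ[ℝ] Z2 G :=
  (chainMap ψ 2).toLinearMap.restrict fun z hz => by
    have hz' : bd G 1 z = 0 := hz
    change bd G 1 (chainMap ψ 2 z) = 0
    rw [bd_chainMap, hz', map_zero]

theorem coe_cycleMap (ψ : MulAut G) (z : Z2 G) :
    ((cycleMap ψ z : Z2 G) : L1 (Fin 2 → G)) = chainMap ψ 2 z := rfl

theorem B2closure_le_comap (ψ : MulAut G) :
    B2closure G ≤ (B2closure G).comap (cycleMap ψ) := by
  intro z hz
  have hz' : (z : L1 (Fin 2 → G)) ∈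
      closure ((LinearMap.range (bd G 2).toLinearMap : Submodule ℝ _) : Set (L1 (Fin 2 → G))) := hz
  change chainMap ψ 2 (z : L1 (Fin 2 → G)) ∈
      closure ((LinearMap.range (bd G 2).toLinearMap : Submodule ℝ _) : Set (L1 (Fin 2 → G)))
  refine map_mem_closure (chainMap ψ 2).continuous hz' ?_
  rintro _ ⟨w, rfl⟩
  exact ⟨chainMap ψ 3 w, bd_chainMap ψ 2 w⟩

/-- The map induced by an automorphism on reduced `ℓ¹`-homology. -/
noncomputable def redMap (ψ : MulAut G) : RedH2 G →ₗ[ℝ] RedH2 G :=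
  (B2closure G).mapQ (B2closure G) (cycleMap ψ) (B2closure_le_comap ψ)

theorem redMap_mk (ψ : MulAut G) (z : Z2 G) :
    redMap ψ (RedH2.mk G z) = RedH2.mk G (cycleMap ψ z) := rfl

theorem norm_redMap_le (ψ : MulAut G) (x : RedH2 G) : ‖redMap ψ x‖ ≤ ‖x‖ := by
  refine le_of_forall_pos_le_add fun ε hε => ?_
  obtain ⟨z, hzx, hz⟩ := Submodule.Quotient.norm_mk_lt (S := B2closure G) x hε
  change RedH2.mk G z = x at hzx
  have h1 : ‖RedH2.mk G (cycleMap ψ z)‖ ≤ ‖cycleMap ψ z‖ := RedH2.norm_mk_le G _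
  have h2 : ‖cycleMap ψ z‖ ≤ ‖z‖ := L1.norm_push_le _ (z : L1 (Fin 2 → G))
  rw [← hzx, redMap_mk]
  rw [hzx]
  exact h1.trans (h2.trans hz.le)

/-- The action of `Aut(G)` on the reduced `ℓ¹`-homology of `G`. -/
noncomputable def autModule (G : Type*) [Group G] : NormedGModule (MulAut G) (RedH2 G) where
  rep :=
    { toFun := redMap
      map_one' := by
        refine RedH2.hom_ext G fun z => ?_
        rw [redMap_mk]
        have : cycleMap (1 : MulAut G) z = z := Subtype.ext (by rw [coe_cycleMap, chainMap_one]; rfl)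
        rw [this]; rfl
      map_mul' := fun φ ψ => by
        refine RedH2.hom_ext G fun z => ?_
        rw [redMap_mk]
        have : cycleMap (φ * ψ) z = cycleMap φ (cycleMap ψ z) :=
          Subtype.ext (by rw [coe_cycleMap, chainMap_mul]; rfl)
        rw [this, Module.End.mul_apply, redMap_mk, redMap_mk] }
  norm_rep_le := norm_redMap_le

/-- The homotopy between conjugation by `t` and the identity, in degree one. -/
noncomputable def conjHomotopy₁ (t : G) : L1 (Fin 1 → G) →L[ℝ] L1 (Fin 2 → G) :=
  L1.push (fun g => ![t * g 0 * t⁻¹, t]) - L1.push (fun g => ![t, g 0])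

/-- The homotopy between conjugation by `t` and the identity, in degree two. -/
noncomputable def conjHomotopy₂ (t : G) : L1 (Fin 2 → G) →L[ℝ] L1 (Fin 3 → G) :=
  L1.push (fun g => ![t, g 0, g 1]) - L1.push (fun g => ![t * g 0 * t⁻¹, t, g 1]) +
    L1.push (fun g => ![t * g 0 * t⁻¹, t * g 1 * t⁻¹, t])

theorem bd_conjHomotopy₂ (t : G) (z : L1 (Fin 2 → G)) :
    bd G 2 (conjHomotopy₂ t z) =
      z - chainMap (MulAut.conj t) 2 z + conjHomotopy₁ t (bd G 1 z) := by
  have : (bd G 2).comp (conjHomotopy₂ t) = ContinuousLinearMap.id ℝ _ -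
      chainMap (MulAut.conj t) 2 + (conjHomotopy₁ t).comp (bd G 1) := by
    refine L1.hom_ext fun g => ?_
    obtain ⟨a, b, rfl⟩ : ∃ a b, g = ![a, b] := ⟨g 0, g 1, by ext i; fin_cases i <;> rfl⟩
    have hc : (fun i => MulAut.conj t (![a, b] i)) = ![t * a * t⁻¹, t * b * t⁻¹] := by
      ext i; fin_cases i <;> rfl
    simp only [ContinuousLinearMap.comp_apply, add_apply,
      sub_apply, ContinuousLinearMap.id_apply, conjHomotopy₂, conjHomotopy₁,
      L1.push_basis, map_add, map_sub, bd_basis_three, bd_basis_two, chainMap_basis, hc,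
      Matrix.cons_val_zero, Matrix.cons_val_one]
    have e1 : t * a * t⁻¹ * t = t * a := by group
    have e2 : t * b * t⁻¹ * t = t * b := by group
    have e3 : t * a * t⁻¹ * (t * b * t⁻¹) = t * (a * b) * t⁻¹ := by group
    rw [e1, e2, e3]
    abel
  exact DFunLike.congr_fun this z

theorem redMap_conj (t : G) : redMap (MulAut.conj t) = 1 := by
  refine RedH2.hom_ext G fun z => ?_
  rw [redMap_mk, Module.End.one_apply, ← sub_eq_zero, ← map_sub, RedH2.mk_eq_zero]
  refine Submodule.le_topologicalClosure _ ⟨-conjHomotopy₂ t z, ?_⟩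
  have hz : bd G 1 (z : L1 (Fin 2 → G)) = 0 := z.2
  change bd G 2 (-conjHomotopy₂ t z) = chainMap (MulAut.conj t) 2 z - z
  rw [map_neg, bd_conjHomotopy₂, hz]
  simp

/-! ### The class `g₂` -/

/-- The chain `m(g) = ∑_{n ≥ 1} 2⁻ⁿ [g^{2ⁿ⁻¹} | g^{2ⁿ⁻¹}]`. -/
noncomputable def m (g : G) : L1 (Fin 2 → G) :=
  ∑' n : ℕ, (1 / 2 : ℝ) ^ (n + 1) • L1.basis ![g ^ 2 ^ n, g ^ 2 ^ n]

theorem norm_m_term (g : G) (n : ℕ) :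
    ‖(1 / 2 : ℝ) ^ (n + 1) • L1.basis ![g ^ 2 ^ n, g ^ 2 ^ n]‖ = 1 / 2 * (1 / 2 : ℝ) ^ n := by
  rw [norm_smul, L1.norm_basis, pow_succ]
  simp [mul_comm]

theorem summable_m (g : G) :
    Summable fun n : ℕ => ‖(1 / 2 : ℝ) ^ (n + 1) • L1.basis ![g ^ 2 ^ n, g ^ 2 ^ n]‖ := by
  simp only [norm_m_term]
  exact (summable_geometric_of_lt_one (by norm_num) (by norm_num)).mul_left _

theorem norm_m_le (g : G) : ‖m g‖ ≤ 1 := by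
  refine (norm_tsum_le_tsum_norm (summable_m g)).trans ?_
  simp only [norm_m_term]
  rw [tsum_mul_left, tsum_geometric_of_lt_one (by norm_num) (by norm_num)]
  norm_num

theorem bd_m (g : G) : bd G 1 (m g) = L1.basis ![g] := by
  rw [m, ContinuousLinearMap.map_tsum _ (summable_m g).of_norm]
  set t : ℕ → L1 (Fin 1 → G) := fun n => (1 / 2 : ℝ) ^ n • L1.basis ![g ^ 2 ^ n] with ht
  have h1 : ∀ n, bd G 1 ((1 / 2 : ℝ) ^ (n + 1) • L1.basis ![g ^ 2 ^ n, g ^ 2 ^ n]) =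
      t n - t (n + 1) := by
    intro n
    have e : g ^ 2 ^ n * g ^ 2 ^ n = g ^ 2 ^ (n + 1) := by rw [← pow_add]; congr 1; ring
    rw [map_smul, bd_basis_two, e]
    simp only [ht, pow_succ, smul_add, smul_sub]
    have : (1 / 2 : ℝ) ^ n • L1.basis ![g ^ 2 ^ n] =
      ((1 / 2 : ℝ) ^ n * (1 / 2)) • L1.basis ![g ^ 2 ^ n] +
      ((1 / 2 : ℝ) ^ n * (1 / 2)) • L1.basis ![g ^ 2 ^ n] := by
      rw [← add_smul]; congr 1; ring
    rw [this]
    abel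
  have hs : Summable fun n => bd G 1 ((1 / 2 : ℝ) ^ (n + 1) • L1.basis ![g ^ 2 ^ n, g ^ 2 ^ n]) :=
    (bd G 1).summable (summable_m g).of_norm
  have h2 := hs.hasSum.tendsto_sum_nat
  have ht0 : Filter.Tendsto t Filter.atTop (nhds 0) := by
    rw [tendsto_zero_iff_norm_tendsto_zero]
    have : (fun n => ‖t n‖) = fun n => (1 / 2 : ℝ) ^ n := by
      funext n
      simp [ht, norm_smul, L1.norm_basis]
    rw [this]
    exact tendsto_pow_atTop_nhds_zero_of_lt_one (by norm_num) (by norm_num)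
  have h3 : Filter.Tendsto (fun N => ∑ n ∈ Finset.range N,
      bd G 1 ((1 / 2 : ℝ) ^ (n + 1) • L1.basis ![g ^ 2 ^ n, g ^ 2 ^ n])) Filter.atTop
      (nhds (t 0)) := by
    simp only [h1, Finset.sum_range_sub']
    simpa using tendsto_const_nhds.sub ht0
  rw [tendsto_nhds_unique h2 h3]
  simp [ht]

/-- The chain `m₂(g, h) = [g|h] - m(g) + m(gh) - m(h)`. -/
noncomputable def m₂ (g h : G) : L1 (Fin 2 → G) := L1.basis ![g, h] - m g + m (g * h) - m h

theorem m₂_mem (g h : G) : m₂ g h ∈ Z2 G := by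
  change bd G 1 (m₂ g h) = 0
  simp only [m₂, map_add, map_sub, bd_m, bd_basis_two]
  abel

theorem norm_m₂_le (g h : G) : ‖m₂ g h‖ ≤ 4 := by
  have h1 := norm_sub_le (L1.basis ![g, h] - m g + m (g * h)) (m h)
  have h2 := norm_add_le (L1.basis ![g, h] - m g) (m (g * h))
  have h3 := norm_sub_le (L1.basis ![g, h]) (m g)
  have h4 := L1.norm_basis ![g, h]
  have := norm_m_le g
  have := norm_m_le h
  have := norm_m_le (g * h)
  rw [m₂]
  linarith

/-- The class of `m₂(g, h)` in reduced `ℓ¹`-homology. -/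
noncomputable def m₂bar (g h : G) : RedH2 G := RedH2.mk G ⟨m₂ g h, m₂_mem g h⟩

theorem norm_m₂bar_le (g h : G) : ‖m₂bar g h‖ ≤ 4 :=
  (RedH2.norm_mk_le G _).trans (norm_m₂_le g h)

/-- The bounded cochain `m₂bar : G² → H̄₂`. -/
noncomputable def m₂Cochain (G : Type*) [Group G] : BCochain 2 G (RedH2 G) :=
  Bdd.mk (fun g => m₂bar (g 0) (g 1)) ⟨4, fun _ => norm_m₂bar_le _ _⟩

theorem m₂Cochain_mem (G : Type*) [Group G] :
    m₂Cochain G ∈ cocycles (NormedGModule.trivial G (RedH2 G)) 2 := by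
  refine LinearMap.mem_ker.2 ?_
  ext x
  rw [d_apply]
  obtain ⟨g, h, k, rfl⟩ : ∃ g h k, x = ![g, h, k] :=
    ⟨x 0, x 1, x 2, by ext i; fin_cases i <;> rfl⟩
  have h1 : Fin.contractNth 0 (· * ·) ![g, h, k] = ![g * h, k] := by
    ext i; fin_cases i <;> rfl
  have h2 : Fin.contractNth 1 (· * ·) ![g, h, k] = ![g, h * k] := by
    ext i; fin_cases i <;> rfl
  have h3 : Fin.contractNth 2 (· * ·) ![g, h, k] = ![g, h] := by ext i; fin_cases i <;> rfl
  rw [dFun, Fin.sum_univ_three, h1, h2, h3]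
  have key : (⟨m₂ h k, m₂_mem h k⟩ : Z2 G) - ⟨m₂ (g * h) k, m₂_mem _ _⟩ +
      ⟨m₂ g (h * k), m₂_mem _ _⟩ - ⟨m₂ g h, m₂_mem _ _⟩ ∈ B2closure G := by
    refine Submodule.le_topologicalClosure _ ⟨L1.basis ![g, h, k], ?_⟩
    change bd G 2 (L1.basis ![g, h, k]) = m₂ h k - m₂ (g * h) k + m₂ g (h * k) - m₂ g h
    rw [bd_basis_three]
    simp only [m₂, mul_assoc]
    abel
  have key2 := (RedH2.mk_eq_zero G).2 key
  simp only [map_add, map_sub] at key2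
  refine Eq.trans ?_ key2
  simp only [m₂Cochain, Bdd.mk_apply, NormedGModule.trivial, m₂bar]
  have h4 : (-1 : ℝ) ^ 3 = -1 := by norm_num
  simp [sub_eq_add_neg, add_assoc, h4]

/-- The class `g₂` in the second bounded cohomology of `G` with coefficients in the trivial
`G`-module `H̄₂(G)`. -/
noncomputable def g₂ (G : Type*) [Group G] : HB (NormedGModule.trivial G (RedH2 G)) 2 :=
  HB.mk _ 2 (m₂Cochain G) (m₂Cochain_mem G)

end ellOne

/-! ### Outer actions and abstract kernels -/

section outer

instance normal_inn (G : Type*) [Group G] : (MulAut.conj : G →* MulAut G).range.Normal where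
  conj_mem := by
    rintro _ ⟨g, rfl⟩ φ
    exact ⟨φ g, by ext x; simp⟩

/-- The group `Out(G) = Aut(G) / Inn(G)`. -/
abbrev Out (G : Type*) [Group G] : Type _ := MulAut G ⧸ (MulAut.conj : G →* MulAut G).range

/-- The class of an automorphism in `Out(G)`. -/
def Out.mk (G : Type*) [Group G] : MulAut G →* Out G := QuotientGroup.mk' _

/-- The action of `Out(G)` on the reduced `ℓ¹`-homology of `G` (inner automorphisms act
trivially). -/
noncomputable def outModule (G : Type*) [Group G] : NormedGModule (Out G) (RedH2 G) :=
  (autModule G).descend (Out.mk G) (QuotientGroup.mk'_surjective _) fun φ hφ => by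
    obtain ⟨t, rfl⟩ := (QuotientGroup.eq_one_iff φ).1 hφ
    exact redMap_conj t

theorem outModule_rep {G : Type*} [Group G] (φ : MulAut G) :
    (outModule G).rep (Out.mk G φ) = redMap φ :=
  NormedGModule.descend_rep _ _ _ _ φ

variable {G Γ P : Type*} [Group G] [Group Γ] [Group P]

/-- The outer action `θ : P → Out(G)` induced by a group extension `1 → G → Γ → P → 1`: the class
`σ(γ)` goes to the class of the automorphism of `G` given by conjugation by `γ` in `Γ`. -/
noncomputable def outerAction (S : GroupExtension G Γ P) : P →* Out G :=
  S.rightHom.liftOfRightInverse (Function.surjInv S.rightHom_surjective)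
    (Function.rightInverse_surjInv S.rightHom_surjective)
    ⟨(Out.mk G).comp S.conjAct, fun γ hγ => by
      obtain ⟨g, rfl⟩ : γ ∈ S.inl.range := by rw [S.range_inl_eq_ker_rightHom]; exact hγ
      refine (QuotientGroup.eq_one_iff _).2 ⟨g, ?_⟩
      ext x
      apply S.inl_injective
      rw [S.inl_conjAct_comm]
      simp⟩

theorem outerAction_rightHom (S : GroupExtension G Γ P) (γ : Γ) :
    outerAction S (S.rightHom γ) = Out.mk G (S.conjAct γ) :=
  MonoidHom.liftOfRightInverse_comp_apply _ _ _ _ _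

/-- The reduced `ℓ¹`-homology of `G` as a module over `P`, for an outer action `θ : P → Out(G)`. -/
noncomputable def redModule (θ : P →* Out G) : NormedGModule P (RedH2 G) := (outModule G).comp θ

/-- An abstract kernel for the outer action `θ : P → Out(G)`: automorphisms `Ψ(α)` of `G` in the
classes `θ(α)`, and elements `f(α, β)` of `G` such that
`Ψ(α) ∘ Ψ(β) = (conjugation by f(α, β)) ∘ Ψ(αβ)`. -/
def IsAbstractKernel (θ : P →* Out G) (Ψ : P → MulAut G) (f : P → P → G) : Prop :=
  (∀ α, Out.mk G (Ψ α) = θ α) ∧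
    ∀ α β, Ψ α * Ψ β = MulAut.conj (f α β) * Ψ (α * β)

/-- The bounded `3`-cochain
`(α, β, γ) ↦ m̄₂(Ψ(α)(f(β, γ)), f(α, βγ)) - m̄₂(f(α, β), f(αβ, γ))`. -/
noncomputable def thetaCochain (Ψ : P → MulAut G) (f : P → P → G) : BCochain 3 P (RedH2 G) :=
  Bdd.mk (fun a => m₂bar (Ψ (a 0) (f (a 1) (a 2))) (f (a 0) (a 1 * a 2)) -
    m₂bar (f (a 0) (a 1)) (f (a 0 * a 1) (a 2)))
    ⟨4 + 4, fun _ => (norm_sub_le _ _).trans (add_le_add (norm_m₂bar_le _ _) (norm_m₂bar_le _ _))⟩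

end outer

/-! ### The spectral sequence of a filtered complex -/

/-- A graded cochain complex of real vector spaces with a positive, decreasing, regular
filtration.  The ambient space `A` contains the homogeneous components `gr n`, `n ∈ ℤ`. -/
structure FilteredComplex (A : Type*) [AddCommGroup A] [Module ℝ A] where
  /-- the differential -/
  D : A →ₗ[ℝ] A
  /-- the component of degree `n` -/
  gr : ℤ → Submodule ℝ A
  /-- the filtration -/
  F : ℤ → Submodule ℝ A
  D_D : ∀ x, D (D x) = 0
  D_gr : ∀ n, ∀ x ∈ gr n, D x ∈ gr (n + 1)
  D_F : ∀ p, ∀ x ∈ F p, D x ∈ F p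
  F_anti : Antitone F
  F_nonpos : ∀ p ≤ 0, F p = ⊤
  regular : ∀ n, ∃ u, ∀ p > u, gr n ⊓ F p = ⊥

namespace FilteredComplex

variable {A : Type*} [AddCommGroup A] [Module ℝ A] (K : FilteredComplex A)

/-- The subspace `Fᵖ Kⁿ`. -/
def FK (p n : ℤ) : Submodule ℝ A := K.F p ⊓ K.gr n

/-- `Z_r^{p,q} = {x ∈ Fᵖ K^{p+q} | D x ∈ F^{p+r} K^{p+q+1}}`. -/
def Z (r p q : ℤ) : Submodule ℝ A := K.FK p (p + q) ⊓ (K.FK (p + r) (p + q + 1)).comap K.D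

/-- `B_r^{p,q} = {x ∈ Fᵖ K^{p+q} | ∃ y ∈ F^{p-r} K^{p+q-1}, D y = x}`. -/
def B (r p q : ℤ) : Submodule ℝ A := K.FK p (p + q) ⊓ (K.FK (p - r) (p + q - 1)).map K.D

/-- The term `E_r^{p,q} = Z_r^{p,q} / (Z_{r-1}^{p+1,q-1} + B_{r-1}^{p,q})`. -/
abbrev E (r p q : ℤ) : Type _ :=
  K.Z r p q ⧸ (K.Z (r - 1) (p + 1) (q - 1) ⊔ K.B (r - 1) p q).submoduleOf (K.Z r p q)

theorem D_mem_Z {r p q p' q' : ℤ} (hp : p' = p + r) (hq : q' = q - r + 1) {x : A}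
    (hx : x ∈ K.Z r p q) : K.D x ∈ K.Z r p' q' := by
  subst hp hq
  have h1 := hx.2
  refine ⟨?_, ?_⟩
  · have : p + r + (q - r + 1) = p + q + 1 := by ring
    rw [this]
    exact h1
  · change K.D (K.D x) ∈ K.FK _ _
    rw [K.D_D]
    exact zero_mem _

/-- The differential `d_r^{p,q} : E_r^{p,q} → E_r^{p+r,q-r+1}`, `[x] ↦ [D x]`. -/
def dE (r p q p' q' : ℤ) (hp : p' = p + r) (hq : q' = q - r + 1) :
    K.E r p q →ₗ[ℝ] K.E r p' q' :=
  Submodule.mapQ _ _ (K.D.restrict (p := K.Z r p q) (q := K.Z r p' q') fun _ hx => K.D_mem_Z hp hq hx) <| by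
    rintro ⟨x, hx⟩ hx'
    change x ∈ K.Z (r - 1) (p + 1) (q - 1) ⊔ K.B (r - 1) p q at hx'
    change K.D x ∈ K.Z (r - 1) (p' + 1) (q' - 1) ⊔ K.B (r - 1) p' q'
    obtain ⟨y, hy, z, ⟨-, w, -, rfl⟩, rfl⟩ := Submodule.mem_sup.1 hx'
    have h := (K.D_mem_Z hp hq hx).1
    rw [map_add, K.D_D, add_zero] at h ⊢
    refine Submodule.mem_sup_right ⟨h, y, ?_, rfl⟩
    · have h1 : p' - (r - 1) = p + 1 := by rw [hp]; ring
      have h2 : p' + q' - 1 = p + 1 + (q - 1) := by rw [hp, hq]; ring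
      rw [h1, h2]
      exact hy.1

theorem dE_mk (r p q p' q' : ℤ) (hp : p' = p + r) (hq : q' = q - r + 1) (x : K.Z r p q) :
    K.dE r p q p' q' hp hq (Submodule.Quotient.mk x) =
      Submodule.Quotient.mk ⟨K.D x, K.D_mem_Z hp hq x.2⟩ := rfl

end FilteredComplex

/-- A double complex of real vector spaces in the first quadrant, with commuting differentials. -/
structure DoubleComplex (K : ℕ → ℕ → Type*) [∀ p q, AddCommGroup (K p q)]
    [∀ p q, Module ℝ (K p q)] where
  /-- the horizontal differential -/
  dh : ∀ p q, K p q →ₗ[ℝ] K (p + 1) q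
  /-- the vertical differential -/
  dv : ∀ p q, K p q →ₗ[ℝ] K p (q + 1)
  dh_dh : ∀ p q x, dh (p + 1) q (dh p q x) = 0
  dv_dv : ∀ p q x, dv p (q + 1) (dv p q x) = 0
  dv_dh : ∀ p q x, dv (p + 1) q (dh p q x) = dh p (q + 1) (dv p q x)

namespace DoubleComplex

variable {K : ℕ → ℕ → Type*} [∀ p q, AddCommGroup (K p q)] [∀ p q, Module ℝ (K p q)]
  (C : DoubleComplex K)

/-- The component in `K^{p,q}` of the horizontal differential `K^{p-1,q} → K^{p,q}`. -/
def hor : (p q : ℕ) → (∀ p q, K p q) →ₗ[ℝ] K p q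
  | 0, _ => 0
  | p + 1, q => C.dh p q ∘ₗ LinearMap.proj q ∘ₗ LinearMap.proj p

/-- The component in `K^{p,q}` of the vertical differential `K^{p,q-1} → K^{p,q}`. -/
def vert : (p q : ℕ) → (∀ p q, K p q) →ₗ[ℝ] K p q
  | _, 0 => 0
  | p, q + 1 => C.dv p q ∘ₗ LinearMap.proj q ∘ₗ LinearMap.proj p

/-- The total differential `d_h + (-1)^p d_v`. -/
def totD : (∀ p q, K p q) →ₗ[ℝ] ∀ p q, K p q :=
  LinearMap.pi fun p => LinearMap.pi fun q => C.hor p q + (-1 : ℝ) ^ p • C.vert p q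

theorem totD_zero_zero (x : ∀ p q, K p q) : C.totD x 0 0 = 0 := by
  simp [totD, hor, vert]

theorem totD_succ_zero (x : ∀ p q, K p q) (p : ℕ) :
    C.totD x (p + 1) 0 = C.dh p 0 (x p 0) := by
  simp [totD, hor, vert]

theorem totD_zero_succ (x : ∀ p q, K p q) (q : ℕ) :
    C.totD x 0 (q + 1) = C.dv 0 q (x 0 q) := by
  simp [totD, hor, vert]

theorem totD_succ_succ (x : ∀ p q, K p q) (p q : ℕ) :
    C.totD x (p + 1) (q + 1) = C.dh p (q + 1) (x p (q + 1)) +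
      (-1 : ℝ) ^ (p + 1) • C.dv (p + 1) q (x (p + 1) q) := by
  simp [totD, hor, vert]

theorem totD_totD (x : ∀ p q, K p q) : C.totD (C.totD x) = 0 := by
  funext p q
  rcases p with _ | _ | p <;> rcases q with _ | _ | q <;>
    simp [totD_zero_zero, totD_succ_zero, totD_zero_succ, totD_succ_succ, C.dh_dh, C.dv_dv,
      C.dv_dh, pow_succ]

/-- The total complex of a double complex, with `Totⁿ = ⨁_{p+q=n} K^{p,q}`, and its filtration
`Fᵖ Tot = ∑_{i ≥ p} K^{i,j}`. -/
def total : FilteredComplex (∀ p q, K p q) where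
  D := C.totD
  gr n :=
    { carrier := {x | ∀ p q : ℕ, (p : ℤ) + q ≠ n → x p q = 0}
      add_mem' := fun hx hy p q h => by
        rw [Pi.add_apply, Pi.add_apply, hx p q h, hy p q h, add_zero]
      zero_mem' := fun _ _ _ => rfl
      smul_mem' := fun c x hx p q h => by
        rw [Pi.smul_apply, Pi.smul_apply, hx p q h, smul_zero] }
  F k :=
    { carrier := {x | ∀ p q : ℕ, (p : ℤ) < k → x p q = 0}
      add_mem' := fun hx hy p q h => by
        rw [Pi.add_apply, Pi.add_apply, hx p q h, hy p q h, add_zero]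
      zero_mem' := fun _ _ _ => rfl
      smul_mem' := fun c x hx p q h => by
        rw [Pi.smul_apply, Pi.smul_apply, hx p q h, smul_zero] }
  D_D := C.totD_totD
  D_gr n x hx p q h := by
    rcases p with _ | p <;> rcases q with _ | q
    · rw [totD_zero_zero]
    · rw [totD_zero_succ, hx 0 q (by push_cast at h ⊢; omega), map_zero]
    · rw [totD_succ_zero, hx p 0 (by push_cast at h ⊢; omega), map_zero]
    · rw [totD_succ_succ, hx p (q + 1) (by push_cast at h ⊢; omega),
        hx (p + 1) q (by push_cast at h ⊢; omega), map_zero, map_zero, smul_zero, add_zero]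
  D_F k x hx p q h := by
    rcases p with _ | p <;> rcases q with _ | q
    · rw [totD_zero_zero]
    · rw [totD_zero_succ, hx 0 q h, map_zero]
    · rw [totD_succ_zero, hx p 0 (by push_cast at h ⊢; omega), map_zero]
    · rw [totD_succ_succ, hx p (q + 1) (by push_cast at h ⊢; omega), hx (p + 1) q h, map_zero,
        map_zero, smul_zero, add_zero]
  F_anti a b hab x hx p q h := hx p q (lt_of_lt_of_le h hab)
  F_nonpos k hk := by
    refine eq_top_iff.2 fun x _ p q h => ?_
    omega
  regular n := ⟨n, fun k hk => by
    refine eq_bot_iff.2 fun x hx => ?_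
    refine (Submodule.mem_bot ℝ).2 (funext fun p => funext fun q => ?_)
    by_cases h : (p : ℤ) < k
    · exact hx.2 p q h
    · exact hx.1 p q (by omega)⟩

/-- The element of the total complex with component `x` in `K^{p,0}` and no other component. -/
def edge (p : ℕ) : K p 0 →ₗ[ℝ] ∀ p q, K p q :=
  LinearMap.single ℝ (fun p => ∀ q, K p q) p ∘ₗ LinearMap.single ℝ (fun q => K p q) 0

theorem edge_zero (p : ℕ) (c : K p 0) : (edge p c : ∀ p q, K p q) p 0 = c := by
  simp [edge]

theorem edge_ne (p : ℕ) (c : K p 0) {i j : ℕ} (h : i ≠ p ∨ j ≠ 0) :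
    (edge p c : ∀ p q, K p q) i j = 0 := by
  by_cases hi : i = p
  · subst hi
    simp [edge, Pi.single_eq_of_ne (h.resolve_left (fun h => h rfl))]
  · simp [edge, Pi.single_eq_of_ne hi]

theorem totD_edge (p : ℕ) (c : K p 0) (hc : C.dv p 0 c = 0) :
    C.totD (edge p c) = edge (p + 1) (C.dh p 0 c) := by
  have hv : ∀ i j, C.dv i j ((edge p c : ∀ p q, K p q) i j) = 0 := by
    intro i j
    by_cases h : i = p ∧ j = 0
    · obtain ⟨rfl, rfl⟩ := h
      rw [edge_zero, hc]
    · rw [edge_ne p c (by tauto), map_zero]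
  funext i j
  rcases i with _ | i <;> rcases j with _ | j
  · rw [totD_zero_zero, edge_ne]; simp
  · rw [totD_zero_succ, hv, edge_ne]; simp
  · rw [totD_succ_zero]
    by_cases hi : i = p
    · subst hi
      rw [edge_zero, edge_zero]
    · rw [edge_ne p c (Or.inl hi), map_zero, edge_ne]
      left; omega
  · rw [totD_succ_succ, hv, edge_ne p c (Or.inr (by omega)), map_zero, smul_zero, add_zero,
      edge_ne]
    right; omega

theorem edge_mem_FK (p : ℕ) (c : K p 0) {k n : ℤ} (hk : k ≤ p) (hn : n = p) :
    edge p c ∈ C.total.FK k n := by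
  refine ⟨fun i j h => edge_ne p c (Or.inl ?_), fun i j h => edge_ne p c ?_⟩
  · omega
  · by_contra h'
    push Not at h'
    obtain ⟨rfl, rfl⟩ := h'
    simp [hn] at h

end DoubleComplex

/-! ### The Hochschild–Serre spectral sequence in bounded cohomology -/

section equivariant

variable {G : Type*} [Group G] {V W : Type*} [NormedAddCommGroup V] [NormedSpace ℝ V]
  [NormedAddCommGroup W] [NormedSpace ℝ W]

theorem d_map (M : NormedGModule G V) (M' : NormedGModule G W) (φ : V →L[ℝ] W)
    (hφ : ∀ g v, φ (M.rep g v) = M'.rep g (φ v)) (n : ℕ) (f : BCochain n G V) :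
    d M' n (Bdd.map φ f) = Bdd.map φ (d M n f) := by
  ext g
  simp only [d_apply, Bdd.map_apply, dFun, map_add, map_sum, map_smul, hφ]

end equivariant

section HochschildSerre

variable {G Γ P : Type*} [Group G] [Group Γ] [Group P] {V : Type*} [NormedAddCommGroup V]
  [NormedSpace ℝ V]

/-- The space `U^q` of bounded `G`-equivariant functions `Γ^{q+1} → V`, that is, of bounded linear
`G`-equivariant maps `ℝ[Γ^{q+1}] → V`, for an extension `1 → G → Γ → P → 1` and a `P`-module `V`;
the group `Γ` acts on `V` through `P`, so that `G` acts trivially on `V`. -/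
noncomputable def U (S : GroupExtension G Γ P) (V : Type*) [NormedAddCommGroup V]
    [NormedSpace ℝ V] (q : ℕ) : Submodule ℝ (Bdd (Fin (q + 1) → Γ) V) where
  carrier := {f | ∀ (g : G) (x : Fin (q + 1) → Γ), f (fun i => S.inl g * x i) = f x}
  add_mem' hf hf' g x := by
    rw [lp.coeFn_add, Pi.add_apply, Pi.add_apply, hf, hf']
  zero_mem' g x := rfl
  smul_mem' c f hf g x := by
    rw [lp.coeFn_smul, Pi.smul_apply, Pi.smul_apply, hf]

noncomputable instance normedAddCommGroup_U (S : GroupExtension G Γ P) (q : ℕ) :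
    NormedAddCommGroup (U S V q) := inferInstance

noncomputable instance normedSpace_U (S : GroupExtension G Γ P) (q : ℕ) :
    NormedSpace ℝ (U S V q) := inferInstance

variable (S : GroupExtension G Γ P) (N : NormedGModule P V)

theorem conjAct_inv_comm (γ : Γ) (g : G) :
    γ⁻¹ * S.inl g = S.inl (S.conjAct γ⁻¹ g) * γ⁻¹ := by
  rw [S.inl_conjAct_comm]; group

/-- The action of `γ ∈ Γ` on `U^q`: `(γ f)(x) = γ f(γ⁻¹ x)`. -/
noncomputable def uAct (q : ℕ) (γ : Γ) : U S V q →ₗ[ℝ] U S V q where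
  toFun f := ⟨Bdd.mk (fun x => N.rep (S.rightHom γ) (f.1 fun i => γ⁻¹ * x i))
      ⟨‖f‖, fun _ => (N.norm_rep_le _ _).trans (bdd_norm_le f.1 _)⟩, fun g x => by
    have h : (fun i => γ⁻¹ * (S.inl g * x i)) =
        fun i => S.inl (S.conjAct γ⁻¹ g) * (γ⁻¹ * x i) := by
      funext i
      rw [← mul_assoc, conjAct_inv_comm, mul_assoc]
    rw [Bdd.mk_apply, Bdd.mk_apply, h, f.2]⟩
  map_add' f f' := by ext x; simp
  map_smul' c f := by ext x; simp

theorem uAct_apply (q : ℕ) (γ : Γ) (f : U S V q) (x : Fin (q + 1) → Γ) :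
    (uAct S N q γ f).1 x = N.rep (S.rightHom γ) (f.1 fun i => γ⁻¹ * x i) := rfl

/-- The module `U^q` over `Γ`. -/
noncomputable def uModuleΓ (q : ℕ) : NormedGModule Γ (U S V q) where
  rep :=
    { toFun := uAct S N q
      map_one' := by
        ext f x
        rw [uAct_apply, map_one, N.rep_one]
        simp
      map_mul' := fun a b => by
        ext f x
        rw [Module.End.mul_apply, uAct_apply, uAct_apply, uAct_apply, map_mul, N.rep_mul]
        simp [mul_assoc] }
  norm_rep_le γ f := lp.norm_le_of_forall_le (norm_nonneg f) fun x =>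
    (N.norm_rep_le _ _).trans (bdd_norm_le f.1 _)

/-- The module `U^q` over `P`: the subgroup `G` of `Γ` acts trivially on `U^q`. -/
noncomputable def uModule (q : ℕ) : NormedGModule P (U S V q) :=
  (uModuleΓ S N q).descend S.rightHom S.rightHom_surjective fun γ hγ => by
    obtain ⟨g, rfl⟩ : γ ∈ S.inl.range := by rw [S.range_inl_eq_ker_rightHom]; exact hγ
    ext f x
    change (uAct S N q (S.inl g) f).1 x = f.1 x
    rw [uAct_apply, hγ, N.rep_one, ← map_inv, f.2]

theorem uModule_rep (q : ℕ) (γ : Γ) (f : U S V q) :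
    (uModule S N q).rep (S.rightHom γ) f = uAct S N q γ f :=
  LinearMap.congr_fun (NormedGModule.descend_rep (uModuleΓ S N q) S.rightHom _ _ γ) f

/-- The coboundary `U^q → U^{q+1}`. -/
noncomputable def uDelta (V : Type*) [NormedAddCommGroup V] [NormedSpace ℝ V] (q : ℕ) : U S V q →L[ℝ] U S V (q + 1) :=
  LinearMap.mkContinuous
    { toFun := fun f => ⟨Bdd.mk (homDelta f.1) ⟨∑ _i : Fin (q + 2), ‖f‖, fun x =>
          (norm_sum_le _ _).trans (Finset.sum_le_sum fun i _ => by
            rw [norm_neg_one_pow_smul]; exact bdd_norm_le f.1 _)⟩, fun g x => by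
        rw [Bdd.mk_apply, Bdd.mk_apply, homDelta, homDelta]
        exact Finset.sum_congr rfl fun i _ => congrArg _ (f.2 g (x ∘ i.succAbove))⟩
      map_add' := fun f f' => by
        ext x
        simp [homDelta, Finset.sum_add_distrib]
      map_smul' := fun c f => by
        ext x
        simp [homDelta, Finset.smul_sum, smul_comm c] }
    (q + 2) fun f => lp.norm_le_of_forall_le (by positivity) fun x => by
      refine (norm_sum_le _ _).trans ((Finset.sum_le_sum fun i _ => ?_).trans
        (b := ∑ _i : Fin (q + 2), ‖f‖) ?_)
      · rw [norm_neg_one_pow_smul]; exact bdd_norm_le f.1 _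
      · simp

theorem uDelta_apply (q : ℕ) (f : U S V q) (x : Fin (q + 2) → Γ) :
    (uDelta S V q f).1 x = homDelta f.1 x := rfl

theorem uDelta_uDelta (q : ℕ) (f : U S V q) : uDelta S V (q + 1) (uDelta S V q f) = 0 := by
  ext x
  exact homDelta_homDelta _ x

theorem uDelta_rep (q : ℕ) (a : P) (f : U S V q) :
    uDelta S V q ((uModule S N q).rep a f) = (uModule S N (q + 1)).rep a (uDelta S V q f) := by
  obtain ⟨γ, rfl⟩ := S.rightHom_surjective a
  rw [uModule_rep, uModule_rep]
  ext x
  rw [uAct_apply, uDelta_apply, uDelta_apply, homDelta, homDelta, map_sum]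
  refine Finset.sum_congr rfl fun i _ => ?_
  rw [map_smul]
  rfl

/-- The space `K^{p,q} = C_b^p(P, U^q)` of bounded cochains. -/
abbrev HSK (V : Type*) [NormedAddCommGroup V] [NormedSpace ℝ V] (p q : ℕ) : Type _ :=
  BCochain p P (U S V q)

noncomputable instance addCommGroup_HSK (p q : ℕ) : AddCommGroup (HSK S V p q) := inferInstance

noncomputable instance module_HSK (p q : ℕ) : Module ℝ (HSK S V p q) := inferInstance

theorem map_uDelta_uDelta (p q : ℕ) (x : HSK S V p q) :
    Bdd.map (uDelta S V (q + 1)) (Bdd.map (uDelta S V q) x) = 0 :=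
  lp.ext (funext fun a => uDelta_uDelta S q (x a))

/-- The double complex `K^{p,q} = C_b^p(P, U^q)` with its differentials `d_P` and `d_U`. -/
noncomputable def hsDouble : DoubleComplex (HSK S V) where
  dh p q := d (uModule S N q) p
  dv _ q := Bdd.map (uDelta S V q)
  dh_dh p q x := d_d (uModule S N q) p x
  dv_dv p q x := map_uDelta_uDelta S p q x
  dv_dh p q x := (d_map _ _ _ (uDelta_rep S N q) p x).symm

/-- The total complex of `K^{p,q}` with the differential `d_P + (-1)^p d_U` and the filtration by
the degree `p`; its spectral sequence is the Hochschild–Serre spectral sequence. -/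
noncomputable def hs : FilteredComplex (∀ p q, HSK S V p q) := (hsDouble S N).total

/-! #### The term `E₃^{0,2}` -/

/-- The restriction to `G` of an element of `U^n`, as an inhomogeneous cochain:
`(g₁, …, gₙ) ↦ u(1, g₁, g₁g₂, …, g₁⋯gₙ)`. -/
noncomputable def resU (n : ℕ) : U S V n →ₗ[ℝ] BCochain n G V where
  toFun u := Bdd.mk (fun g => u.1 fun i => S.inl (Fin.partialProd g i))
    ⟨‖u‖, fun _ => bdd_norm_le u.1 _⟩
  map_add' u u' := by ext g; simp
  map_smul' c u := by ext g; simp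

theorem resU_apply (n : ℕ) (u : U S V n) (g : Fin n → G) :
    resU S n u g = u.1 fun i => S.inl (Fin.partialProd g i) := rfl

theorem homog_resU (n : ℕ) (u : U S V n) (x : Fin (n + 1) → G) :
    homog (NormedGModule.trivial G V) (resU S n u) x = u.1 fun i => S.inl (x i) := by
  have hx := congrFun (Fin.partialProd_left_inv x)
  rw [homog, resU_apply]
  change (u.1 _ : V) = _
  rw [← u.2 (x 0)]
  refine congrArg u.1 (funext fun i => ?_)
  rw [← map_mul]
  exact congrArg _ (hx i)

theorem d_resU (n : ℕ) (u : U S V n) :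
    d (NormedGModule.trivial G V) n (resU S n u) = resU S (n + 1) (uDelta S V n u) := by
  ext g
  rw [d_apply, ← homDelta_homog_partialProd, resU_apply, uDelta_apply, homDelta, homDelta]
  refine Finset.sum_congr rfl fun i _ => ?_
  rw [homog_resU]
  rfl

/-- The restriction to `G` of the component in `K^{0,2} = U²` of an element of the total complex. -/
noncomputable def resTot : (∀ p q, HSK S V p q) →ₗ[ℝ] BCochain 2 G V where
  toFun x := resU S 2 (x 0 2 Fin.elim0)
  map_add' x y := map_add (resU S 2) (x 0 2 Fin.elim0) (y 0 2 Fin.elim0)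
  map_smul' c x := map_smul (resU S 2) c (x 0 2 Fin.elim0)

theorem resTot_D (x : ∀ p q, HSK S V p q) :
    resTot S ((hs S N).D x) = d (NormedGModule.trivial G V) 1 (resU S 1 (x 0 1 Fin.elim0)) := by
  rw [d_resU]
  have h : (hs S N).D x 0 2 = Bdd.map (uDelta S V 1) (x 0 1) := (hsDouble S N).totD_zero_succ x 1
  change resU S 2 ((hs S N).D x 0 2 Fin.elim0) = _
  rw [h]
  rfl

theorem resTot_mem {x : ∀ p q, HSK S V p q} (hx : x ∈ (hs S N).Z 3 0 2) :
    resTot S x ∈ cocycles (NormedGModule.trivial G V) 2 := by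
  have h : (hs S N).D x 0 3 = Bdd.map (uDelta S V 2) (x 0 2) := (hsDouble S N).totD_zero_succ x 2
  have h1 : (hs S N).D x 0 3 = 0 := hx.2.1 0 3 (by norm_num)
  rw [h] at h1
  have h2 : uDelta S V 2 (x 0 2 Fin.elim0) = 0 := congrArg (fun y => y.1 Fin.elim0) h1
  refine LinearMap.mem_ker.2 ?_
  change d _ 2 (resU S 2 (x 0 2 Fin.elim0)) = 0
  rw [d_resU, h2, map_zero]

theorem resTot_mem_coboundaries {x : ∀ p q, HSK S V p q}
    (hx : x ∈ (hs S N).Z (3 - 1) (0 + 1) (2 - 1) ⊔ (hs S N).B (3 - 1) 0 2) :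
    resTot S x ∈ coboundaries (NormedGModule.trivial G V) 2 := by
  obtain ⟨y, hy, z, ⟨-, w, -, rfl⟩, rfl⟩ := Submodule.mem_sup.1 hx
  have h1 : y 0 2 = 0 := hy.1.1 0 2 (by norm_num)
  have h2 : resTot S y = 0 := by
    change resU S 2 (y 0 2 Fin.elim0) = 0
    rw [h1]
    exact map_zero (resU S 2)
  rw [map_add, h2, zero_add, resTot_D]
  exact ⟨_, rfl⟩

/-- The map `E₃^{0,2} → H_b²(G, V)` given by restriction to `G`. -/
noncomputable def res : (hs S N).E 3 0 2 →ₗ[ℝ] HB (NormedGModule.trivial G V) 2 :=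
  Submodule.mapQ _ _ ((resTot S).restrict (p := (hs S N).Z 3 0 2)
      (q := cocycles (NormedGModule.trivial G V) 2) fun _ hx => resTot_mem S N hx)
    fun _ hx => resTot_mem_coboundaries S N hx

/-- The action of `γ ∈ Γ` on bounded cochains of `G` with values in `V`:
`(γ c)(g₁, …, gₙ) = γ c(γ⁻¹g₁γ, …, γ⁻¹gₙγ)`. -/
noncomputable def conjCochain (n : ℕ) (γ : Γ) : BCochain n G V →ₗ[ℝ] BCochain n G V where
  toFun c := Bdd.mk (fun g => N.rep (S.rightHom γ) (c fun i => S.conjAct γ⁻¹ (g i)))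
    ⟨‖c‖, fun _ => (N.norm_rep_le _ _).trans (bdd_norm_le c _)⟩
  map_add' c c' := by ext g; exact map_add (N.rep (S.rightHom γ)) _ _
  map_smul' r c := by ext g; exact map_smul (N.rep (S.rightHom γ)) _ _

theorem conjCochain_apply (n : ℕ) (γ : Γ) (c : BCochain n G V) (g : Fin n → G) :
    conjCochain S N n γ c g = N.rep (S.rightHom γ) (c fun i => S.conjAct γ⁻¹ (g i)) := rfl

theorem d_conjCochain (n : ℕ) (γ : Γ) (c : BCochain n G V) :
    d (NormedGModule.trivial G V) n (conjCochain S N n γ c) =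
      conjCochain S N (n + 1) γ (d (NormedGModule.trivial G V) n c) := by
  ext g
  rw [conjCochain_apply, d_apply, d_apply, dFun, dFun, map_add, map_sum]
  congr 1
  refine Finset.sum_congr rfl fun j _ => ?_
  rw [map_smul, conjCochain_apply]
  exact congrArg (fun y => (-1 : ℝ) ^ ((j : ℕ) + 1) • N.rep (S.rightHom γ) (c y))
    (Fin.comp_contractNth (· * ·) (· * ·) (f := S.conjAct γ⁻¹) (map_mul _) j g)

/-- The action of `γ ∈ Γ` on `H_b²(G, V)`. -/
noncomputable def conjHB (γ : Γ) :
    HB (NormedGModule.trivial G V) 2 →ₗ[ℝ] HB (NormedGModule.trivial G V) 2 :=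
  Submodule.mapQ _ _ ((conjCochain S N 2 γ).restrict
      (p := cocycles (NormedGModule.trivial G V) 2)
      (q := cocycles (NormedGModule.trivial G V) 2) fun c hc => by
        refine LinearMap.mem_ker.2 ?_
        rw [d_conjCochain, LinearMap.mem_ker.1 hc, map_zero]) <| by
    rintro ⟨c, hc⟩ ⟨b, rfl⟩
    exact ⟨conjCochain S N 1 γ b, d_conjCochain S N 1 γ b⟩

/-- The space `H_b²(G, V)^P` of invariant classes (the action of `Γ` on `H_b²(G, V)` factors
through `P`, as `G` acts trivially). -/
noncomputable def invariants : Submodule ℝ (HB (NormedGModule.trivial G V) 2) :=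
  ⨅ γ : Γ, LinearMap.ker (conjHB S N γ - LinearMap.id)

theorem mem_invariants (c : HB (NormedGModule.trivial G V) 2) :
    c ∈ invariants S N ↔ ∀ γ, conjHB S N γ c = c := by
  simp [invariants, sub_eq_zero]

/-! #### The term `E₃^{3,0}` -/

/-- The constant functions in `U⁰`. -/
noncomputable def constU (V : Type*) [NormedAddCommGroup V] [NormedSpace ℝ V] :
    V →L[ℝ] U S V 0 :=
  LinearMap.mkContinuous
    { toFun := fun v => ⟨Bdd.mk (fun _ => v) ⟨‖v‖, fun _ => le_rfl⟩, fun _ _ => rfl⟩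
      map_add' := fun _ _ => rfl
      map_smul' := fun _ _ => rfl }
    1 fun v => by
      rw [one_mul]
      exact lp.norm_le_of_forall_le (norm_nonneg v) fun _ => le_rfl

theorem constU_apply (v : V) (x : Fin 1 → Γ) : (constU S V v).1 x = v := rfl

theorem constU_rep (a : P) (v : V) :
    constU S V (N.rep a v) = (uModule S N 0).rep a (constU S V v) := by
  obtain ⟨γ, rfl⟩ := S.rightHom_surjective a
  rw [uModule_rep]
  rfl

theorem uDelta_constU (v : V) : uDelta S V 0 (constU S V v) = 0 := by
  ext x
  rw [uDelta_apply, homDelta]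
  simp [constU_apply]

/-- The bounded cochains of `P` with values in `V`, as elements of the total complex: they are
put in `K^{p,0}`, as cochains with values in the constant functions in `U⁰`. -/
noncomputable def inflTot (p : ℕ) : BCochain p P V →ₗ[ℝ] ∀ p q, HSK S V p q :=
  DoubleComplex.edge p ∘ₗ Bdd.map (constU S V)

theorem D_inflTot (p : ℕ) (c : BCochain p P V) :
    (hs S N).D (inflTot S p c) = inflTot S (p + 1) (d N p c) := by
  refine ((hsDouble S N).totD_edge p _ (lp.ext (funext fun a => ?_))).trans ?_
  · exact uDelta_constU S (c a)
  · exact congrArg (DoubleComplex.edge (p + 1)) (d_map _ _ _ (constU_rep S N) p c)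

theorem inflTot_mem_FK (p : ℕ) (c : BCochain p P V) {k n : ℤ} (hk : k ≤ p) (hn : n = p) :
    inflTot S p c ∈ (hs S N).FK k n :=
  (hsDouble S N).edge_mem_FK p _ hk hn

theorem inflTot_mem_Z {c : BCochain 3 P V} (hc : c ∈ cocycles N 3) :
    inflTot S 3 c ∈ (hs S N).Z 3 3 0 := by
  refine ⟨inflTot_mem_FK S N 3 c (by norm_num) (by norm_num), ?_⟩
  change (hs S N).D (inflTot S 3 c) ∈ (hs S N).FK _ _
  rw [D_inflTot, LinearMap.mem_ker.1 hc, map_zero]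
  exact zero_mem _

theorem inflTot_mem_B {c : BCochain 3 P V} (hc : c ∈ coboundaries N 3) :
    inflTot S 3 c ∈ (hs S N).B (3 - 1) 3 0 := by
  obtain ⟨b, rfl⟩ := hc
  exact ⟨inflTot_mem_FK S N 3 _ (by norm_num) (by norm_num), inflTot S 2 b,
    inflTot_mem_FK S N 2 b (by norm_num) (by norm_num), D_inflTot S N 2 b⟩

/-- The map `H_b³(P, V) → E₃^{3,0}` given by the inclusion of `C_b³(P, V)` into `K^{3,0}`. -/
noncomputable def infl : HB N 3 →ₗ[ℝ] (hs S N).E 3 3 0 :=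
  Submodule.mapQ _ _ ((inflTot S 3).restrict (p := cocycles N 3) (q := (hs S N).Z 3 3 0)
      fun _ hc => inflTot_mem_Z S N hc)
    fun _ hc => Submodule.mem_sup_right (inflTot_mem_B S N hc)

/-- The differential `d₃ : E₃^{0,2} → E₃^{3,0}`. -/
noncomputable def d₃ : (hs S N).E 3 0 2 →ₗ[ℝ] (hs S N).E 3 3 0 :=
  (hs S N).dE 3 0 2 3 0 (by norm_num) (by norm_num)

end HochschildSerre
end BddCoh

namespace BddCoh

/-! ### The coboundary in low degrees -/

section lowDegree

variable {H W : Type*} [Group H] [NormedAddCommGroup W] [NormedSpace ℝ W] (M : NormedGModule H W)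

/-! Write V for the reduced homology of G and Π for the quotient (`P` in the code). A bounded
homomorphism from a group to a normed space vanishes, so the complex U has no cohomology in degree
1; in degree 0 its cohomology is V (the constants), in degree 2 it is H_b²(G, V). The row q = 1 of
the E₂-term is therefore zero, which forces E₃^{0,2} to be the invariants of H_b²(G, V) and E₃^{3,0}
to be H_b³(Π, V). The double complex consists of bounded functions with values in U, so each
exactness statement must provide primitives of uniformly controlled norm. In degree 2 this control
comes from the estimate ‖b‖ ≤ ‖db‖ for bounded functions b on G (`norm_le_norm_d_one`,
`exists_uDelta_eq_of_resU_mem`, `exists_uDelta_eq_one`).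

The cocycle m̄₂ is rigid. It is natural under automorphisms, hence invariant under conjugation.
Boundedness yields further exact identities: m̄₂(tgt⁻¹, t) = m̄₂(t, g) (`m₂bar_conj_swap`), and m̄₂
vanishes on commuting pairs (`m₂bar_of_commute`), so m̄₂(a, b) depends only on a and b modulo the
centre (`m₂bar_congr`).

A section s of the extension, with factor set f, gives an explicit lift of g₂ to the total complex.
Its (0,2)-component is m̄₂ evaluated on the G-coordinates of points of Γ. Translation by s(α)
changes this component by the coboundary of a prism term (`liftOne`). The Π-coboundary of the prism
terms is, up to sign, the U-coboundary of θ with its last variable moved to Γ (`liftTwo`). By the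
cocycle identity of θ, the last remaining component of the total differential is θ itself
(`D_lift`).

For an arbitrary abstract kernel (Ψ, f), the automorphisms Ψ(α) are conjugations by some section,
and f agrees with its factor set modulo the centre, so both give the same cochain θ. The class does
not depend on the kernel because all these lifts restrict to g₂ while `res` and `infl` are
injective. -/

theorem d_zero_apply (f : BCochain 0 H W) (g : Fin 1 → H) :
    d M 0 f g = M.rep (g 0) (f Fin.elim0) - f Fin.elim0 := by
  rw [d_apply, dFun, Fin.sum_univ_one, Subsingleton.elim (fun i : Fin 0 => g i.succ) Fin.elim0,
    Subsingleton.elim (Fin.contractNth 0 (· * ·) g) Fin.elim0]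
  simp [sub_eq_add_neg]

theorem d_one_apply (f : BCochain 1 H W) (a b : H) :
    d M 1 f ![a, b] = M.rep a (f ![b]) - f ![a * b] + f ![a] := by
  have h0 : (fun i : Fin 1 => (![a, b] : Fin 2 → H) i.succ) = ![b] := by
    ext i; fin_cases i; rfl
  have h1 : Fin.contractNth 0 (· * ·) ![a, b] = ![a * b] := by ext i; fin_cases i; rfl
  have h2 : Fin.contractNth 1 (· * ·) ![a, b] = ![a] := by ext i; fin_cases i; rfl
  rw [d_apply, dFun, Fin.sum_univ_two, h0, h1, h2]
  simp [sub_eq_add_neg, add_assoc]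

theorem d_two_apply (f : BCochain 2 H W) (a b c : H) :
    d M 2 f ![a, b, c] =
      M.rep a (f ![b, c]) - f ![a * b, c] + f ![a, b * c] - f ![a, b] := by
  have h0 : (fun i : Fin 2 => (![a, b, c] : Fin 3 → H) i.succ) = ![b, c] := by
    ext i; fin_cases i <;> rfl
  have h1 : Fin.contractNth 0 (· * ·) ![a, b, c] = ![a * b, c] := by
    ext i; fin_cases i <;> rfl
  have h2 : Fin.contractNth 1 (· * ·) ![a, b, c] = ![a, b * c] := by
    ext i; fin_cases i <;> rfl
  have h3 : Fin.contractNth 2 (· * ·) ![a, b, c] = ![a, b] := by ext i; fin_cases i <;> rfl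
  have h4 : (-1 : ℝ) ^ 3 = -1 := by norm_num
  rw [d_apply, dFun, Fin.sum_univ_three, h0, h1, h2, h3]
  simp [sub_eq_add_neg, add_assoc, h4]

end lowDegree

/-! ### Bounded functions satisfying additivity conditions -/

section boundedness

variable {V : Type*} [NormedAddCommGroup V] [NormedSpace ℝ V]

theorem eq_zero_of_forall_norm_two_pow_smul_le {v : V} {C : ℝ}
    (h : ∀ n : ℕ, ‖(2 : ℝ) ^ n • v‖ ≤ C) : v = 0 := by
  by_contra hv
  have hv' : 0 < ‖v‖ := norm_pos_iff.2 hv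
  obtain ⟨n, hn⟩ := pow_unbounded_of_one_lt (C / ‖v‖) (one_lt_two : (1 : ℝ) < 2)
  have := h n
  rw [norm_smul, norm_pow, Real.norm_ofNat] at this
  rw [div_lt_iff₀ hv'] at hn
  linarith

/-- The values φ(a^(2ⁿ)) = 2ⁿ φ(a) stay bounded. This is the vanishing of H_b¹(G, V) for trivial
coefficients. -/
theorem eq_zero_of_additive_of_bounded {G : Type*} [Group G] {φ : G → V}
    (hφ : ∀ a b, φ (a * b) = φ a + φ b) {C : ℝ} (hC : ∀ a, ‖φ a‖ ≤ C) (a : G) : φ a = 0 := by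
  refine eq_zero_of_forall_norm_two_pow_smul_le (C := C) fun n => ?_
  have : φ (a ^ 2 ^ n) = (2 : ℝ) ^ n • φ a := by
    induction n with
    | zero => simp
    | succ n ih => rw [pow_succ, pow_mul, pow_two, hφ, ih, ← two_smul ℝ, smul_smul, pow_succ']
  rw [← this]
  exact hC _

/-- A bounded function on a group is bounded by its defect. -/
theorem norm_le_norm_d_one {G : Type*} [Group G] (b : BCochain 1 G V) :
    ‖b‖ ≤ ‖d (NormedGModule.trivial G V) 1 b‖ := by
  -- From db(g, g) = 2b(g) - b(g²); taking the supremum over g gives 2‖b‖ ≤ ‖b‖ + ‖db‖.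
  have h : ∀ g : Fin 1 → G, 2 * ‖b g‖ ≤ ‖b‖ + ‖d (NormedGModule.trivial G V) 1 b‖ := by
    intro g
    have h0 : d (NormedGModule.trivial G V) 1 b ![g 0, g 0] = (2 : ℝ) • b g - b ![g 0 * g 0] := by
      have e : ![g 0] = g := by ext i; fin_cases i; rfl
      rw [d_one_apply, e, two_smul]
      simp only [NormedGModule.trivial, MonoidHom.one_apply, Module.End.one_apply]
      abel
    have h1 : (2 : ℝ) • b g = b ![g 0 * g 0] + d (NormedGModule.trivial G V) 1 b ![g 0, g 0] := by
      rw [h0]; abel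
    calc 2 * ‖b g‖ = ‖(2 : ℝ) • b g‖ := by rw [norm_smul, Real.norm_ofNat]
      _ ≤ _ := by
        rw [h1]
        exact (norm_add_le _ _).trans (add_le_add (bdd_norm_le b _) (bdd_norm_le _ _))
  have h2 : ‖b‖ ≤ (‖b‖ + ‖d (NormedGModule.trivial G V) 1 b‖) / 2 :=
    lp.norm_le_of_forall_le (by positivity) fun g => by linarith [h g]
  linarith

end boundedness

/-! ### Properties of the cocycle `m₂bar` -/

section m₂bar

variable {G : Type*} [Group G]

theorem m₂bar_cocycle (g h k : G) :
    m₂bar g h + m₂bar (g * h) k = m₂bar g (h * k) + m₂bar h k := by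
  have h0 : d (NormedGModule.trivial G (RedH2 G)) 2 (m₂Cochain G) ![g, h, k] = 0 := by
    rw [LinearMap.mem_ker.1 (m₂Cochain_mem G)]; rfl
  rw [d_two_apply] at h0
  simp only [NormedGModule.trivial, MonoidHom.one_apply, Module.End.one_apply, m₂Cochain,
    Bdd.mk_apply, Matrix.cons_val_zero, Matrix.cons_val_one] at h0
  linear_combination (norm := module) (-1 : ℝ) • h0

theorem chainMap_m (ψ : MulAut G) (g : G) : chainMap ψ 2 (m g) = m (ψ g) := by
  rw [m, ContinuousLinearMap.map_tsum _ (summable_m g).of_norm, m]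
  refine tsum_congr fun n => ?_
  rw [map_smul, chainMap_basis, ← map_pow]
  congr 2
  ext i; fin_cases i <;> rfl

theorem redMap_m₂bar (ψ : MulAut G) (g h : G) :
    redMap ψ (m₂bar g h) = m₂bar (ψ g) (ψ h) := by
  have e : (fun i => ψ (![g, h] i)) = ![ψ g, ψ h] := by ext i; fin_cases i <;> rfl
  rw [m₂bar, redMap_mk, m₂bar]
  congr 1
  refine Subtype.ext ?_
  rw [coe_cycleMap]
  simp only [m₂, map_add, map_sub, chainMap_m, chainMap_basis, map_mul, e]

/-- Naturality, combined with the triviality of the action of inner automorphisms on reduced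
homology. -/
theorem m₂bar_conj (t g h : G) : m₂bar (t * g * t⁻¹) (t * h * t⁻¹) = m₂bar g h := by
  have := redMap_m₂bar (MulAut.conj t) g h
  rw [redMap_conj] at this
  exact this.symm

/-- For fixed t the difference of the two sides is a homomorphism in g, by three cocycle identities
and conjugation invariance; it is bounded, hence zero. -/
theorem m₂bar_conj_swap (t g : G) : m₂bar (t * g * t⁻¹) t = m₂bar t g := by
  refine sub_eq_zero.1 (eq_zero_of_additive_of_bounded
    (φ := fun g => m₂bar (t * g * t⁻¹) t - m₂bar t g) (fun a b => ?_) (C := 4 + 4) (fun a =>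
      (norm_sub_le _ _).trans (add_le_add (norm_m₂bar_le _ _) (norm_m₂bar_le _ _))) g)
  have h1 := m₂bar_cocycle (t * a * t⁻¹) (t * b * t⁻¹) t
  have h2 := m₂bar_cocycle (t * a * t⁻¹) t b
  have h3 := m₂bar_cocycle t a b
  rw [m₂bar_conj] at h1
  have e1 : t * a * t⁻¹ * (t * b * t⁻¹) = t * (a * b) * t⁻¹ := by group
  have e2 : t * b * t⁻¹ * t = t * b := by group
  have e3 : t * a * t⁻¹ * t = t * a := by group
  rw [e1, e2] at h1
  rw [e3] at h2
  linear_combination (norm := module) h1 - h2 + h3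

/-- The term n = 0 of the series is split off; the rest is half the series of g². -/
theorem m_eq (g : G) : m g = (1 / 2 : ℝ) • L1.basis ![g, g] + (1 / 2 : ℝ) • m (g * g) := by
  rw [m, (summable_m g).of_norm.tsum_eq_zero_add, m, ← tsum_const_smul'']
  congr 1
  · simp
  · refine tsum_congr fun n => ?_
    have e : (g * g) ^ 2 ^ n = g ^ 2 ^ (n + 1) := by rw [← pow_two, ← pow_mul, pow_succ']
    rw [e, smul_smul, ← pow_succ']

/-- Already the chain [g|g] - 2m(g) + m(g²) vanishes, by the functional equation of m. -/
theorem m₂bar_self (g : G) : m₂bar g g = 0 := by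
  have h : m₂ g g = 0 := by
    rw [m₂, m_eq g]
    module
  have h' : (⟨m₂ g g, m₂_mem g g⟩ : Z2 G) = 0 := Subtype.ext h
  rw [m₂bar, h', map_zero]

/-- For commuting elements the swap identity makes m̄₂ symmetric, and m̄₂ vanishes on the diagonal;
four cocycle identities then give the doubling formula. -/
theorem m₂bar_sq_sq {g h : G} (H : Commute g h) :
    m₂bar (g * g) (h * h) = (2 : ℝ) • m₂bar g h := by
  have hs : m₂bar h g = m₂bar g h := by
    have := m₂bar_conj_swap g h
    rwa [H.eq, mul_inv_cancel_right] at this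
  have h1 := m₂bar_cocycle (g * g) h h
  have h2 := m₂bar_cocycle g g h
  have h3 := m₂bar_cocycle (g * h) g h
  have h4 := m₂bar_cocycle g h g
  have e : g * h * g = g * g * h := by rw [mul_assoc, ← H.eq, mul_assoc]
  rw [m₂bar_self] at h1 h2 h3
  rw [e] at h3
  rw [← H.eq, hs] at h4
  rw [two_smul]
  linear_combination (norm := module) h3 - h4 + h2 - h1

/-- Iterated doubling gives 2ⁿ m̄₂(g, h) = m̄₂(g^(2ⁿ), h^(2ⁿ)), whose norm is at most 4. -/
theorem m₂bar_of_commute {g h : G} (H : Commute g h) : m₂bar g h = 0 := by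
  refine eq_zero_of_forall_norm_two_pow_smul_le (C := 4) fun n => ?_
  have : (2 : ℝ) ^ n • m₂bar g h = m₂bar (g ^ 2 ^ n) (h ^ 2 ^ n) := by
    induction n with
    | zero => simp
    | succ n ih =>
      rw [pow_succ', ← smul_smul, ih, pow_succ, pow_mul, pow_two, pow_mul h, pow_two,
        m₂bar_sq_sq (H.pow_pow _ _)]
  rw [this]
  exact norm_m₂bar_le _ _

/-- Elements inducing the same inner automorphism differ by a central factor. The cocycle identity
removes this factor, since m̄₂ vanishes whenever one argument is central. -/
theorem m₂bar_congr {a a' b b' : G} (ha : MulAut.conj a = MulAut.conj a')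
    (hb : MulAut.conj b = MulAut.conj b') : m₂bar a b = m₂bar a' b' := by
  have key : ∀ x y : G, MulAut.conj x = MulAut.conj y → ∀ g, Commute (x * y⁻¹) g := by
    intro x y hxy g
    have h1 : x * (y⁻¹ * g * y) * x⁻¹ = y * (y⁻¹ * g * y) * y⁻¹ := DFunLike.congr_fun hxy _
    have h2 : y * (y⁻¹ * g * y) * y⁻¹ = g := by group
    rw [h2] at h1
    have h3 : x * y⁻¹ * g = x * (y⁻¹ * g * y) * x⁻¹ * (x * y⁻¹) := by group
    rw [Commute, SemiconjBy, h3, h1]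
  have hl : m₂bar a b = m₂bar a' b := by
    have h1 := m₂bar_cocycle (a * a'⁻¹) a' b
    rw [m₂bar_of_commute (key _ _ ha _), m₂bar_of_commute (key _ _ ha _),
      inv_mul_cancel_right, zero_add, zero_add] at h1
    exact h1
  have hr : m₂bar a' b = m₂bar a' b' := by
    have h1 := m₂bar_cocycle a' b' (b * b'⁻¹)
    rw [m₂bar_of_commute (key _ _ hb _).symm, m₂bar_of_commute (key _ _ hb _).symm,
      ← (key _ _ hb b').eq, inv_mul_cancel_right, add_zero, add_zero] at h1
    exact h1.symm
  rw [hl, hr]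

end m₂bar

/-! ### Exactness properties of the complex `U` -/

/-- The uniform constant C is what makes the function of pointwise chosen preimages bounded. -/
theorem Bdd.exists_map_eq {T V W : Type*} [NormedAddCommGroup V] [NormedSpace ℝ V]
    [NormedAddCommGroup W] [NormedSpace ℝ W] (φ : V →L[ℝ] W) (f : Bdd T W) (C : ℝ)
    (h : ∀ t, ∃ v, φ v = f t ∧ ‖v‖ ≤ C) : ∃ g : Bdd T V, Bdd.map φ g = f := by
  choose v hv hC using h
  exact ⟨Bdd.mk v ⟨C, hC⟩, lp.ext (funext hv)⟩

/-! ### The homogeneous coboundary in low degrees -/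

section homDelta

variable {X V : Type*} [NormedAddCommGroup V] [NormedSpace ℝ V]

theorem homDelta_one (F : (Fin 1 → X) → V) (x y : X) :
    homDelta F ![x, y] = F ![y] - F ![x] := by
  have h0 : ![x, y] ∘ (0 : Fin 2).succAbove = ![y] := by ext i; fin_cases i; rfl
  have h1 : ![x, y] ∘ (1 : Fin 2).succAbove = ![x] := by ext i; fin_cases i; rfl
  rw [homDelta, Fin.sum_univ_two, h0, h1]
  simp [sub_eq_add_neg]

theorem homDelta_two (F : (Fin 2 → X) → V) (x y z : X) :
    homDelta F ![x, y, z] = F ![y, z] - F ![x, z] + F ![x, y] := by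
  have h0 : ![x, y, z] ∘ (0 : Fin 3).succAbove = ![y, z] := by ext i; fin_cases i <;> rfl
  have h1 : ![x, y, z] ∘ (1 : Fin 3).succAbove = ![x, z] := by ext i; fin_cases i <;> rfl
  have h2 : ![x, y, z] ∘ (2 : Fin 3).succAbove = ![x, y] := by ext i; fin_cases i <;> rfl
  rw [homDelta, Fin.sum_univ_three, h0, h1, h2]
  simp [sub_eq_add_neg]

theorem homDelta_three (F : (Fin 3 → X) → V) (x y z w : X) :
    homDelta F ![x, y, z, w] =
      F ![y, z, w] - F ![x, z, w] + F ![x, y, w] - F ![x, y, z] := by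
  have h0 : ![x, y, z, w] ∘ (0 : Fin 4).succAbove = ![y, z, w] := by ext i; fin_cases i <;> rfl
  have h1 : ![x, y, z, w] ∘ (1 : Fin 4).succAbove = ![x, z, w] := by ext i; fin_cases i <;> rfl
  have h2 : ![x, y, z, w] ∘ (2 : Fin 4).succAbove = ![x, y, w] := by ext i; fin_cases i <;> rfl
  have h3 : ![x, y, z, w] ∘ (3 : Fin 4).succAbove = ![x, y, z] := by ext i; fin_cases i <;> rfl
  have h4 : (-1 : ℝ) ^ 3 = -1 := by norm_num
  rw [homDelta, Fin.sum_univ_four, h0, h1, h2, h3]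
  simp [sub_eq_add_neg, h4]

end homDelta

/-! ### Sections of the extension, coordinates and factor sets -/

section sections

variable {G Γ P : Type*} [Group G] [Group Γ] [Group P] {S : GroupExtension G Γ P}

theorem exists_inl_eq {γ : Γ} (h : S.rightHom γ = 1) : ∃ g, S.inl g = γ := by
  have h' : γ ∈ S.inl.range := by rw [S.range_inl_eq_ker_rightHom]; exact h
  exact h'

theorem conjAct_inl (t : G) : S.conjAct (S.inl t) = MulAut.conj t := by
  ext x
  apply S.inl_injective
  rw [S.inl_conjAct_comm]
  simp

/-- The coordinate `g` of `x = g s(σ(x))` with respect to a section `s` of `σ`. -/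
noncomputable def coord (s : S.Section) (x : Γ) : G :=
  (exists_inl_eq (S := S) (γ := x * (s (S.rightHom x))⁻¹) (by simp)).choose

theorem inl_coord (s : S.Section) (x : Γ) : S.inl (coord s x) = x * (s (S.rightHom x))⁻¹ :=
  (exists_inl_eq (S := S) (γ := x * (s (S.rightHom x))⁻¹) (by simp)).choose_spec

theorem coord_inl_mul (s : S.Section) (g : G) (x : Γ) :
    coord s (S.inl g * x) = g * coord s x := by
  apply S.inl_injective
  simp [inl_coord, mul_assoc]

/-- An arbitrary section is multiplied by s(1)⁻¹. With this normalisation, restriction to G undoes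
`extU` exactly and not only up to conjugation. -/
theorem exists_section_map_one (S : GroupExtension G Γ P) : ∃ s : S.Section, coord s 1 = 1 := by
  let s₀ := Function.surjInv S.rightHom_surjective
  have hs₀ : ∀ α, S.rightHom (s₀ α) = α := Function.surjInv_eq S.rightHom_surjective
  refine ⟨⟨fun α => s₀ α * (s₀ 1)⁻¹, fun α => by simp [hs₀]⟩, S.inl_injective ?_⟩
  rw [inl_coord]
  simp

/-- The factor set `f(α, β) = s(α) s(β) s(αβ)⁻¹` of a section. -/
noncomputable def factorSet (s : S.Section) (α β : P) : G :=
  (exists_inl_eq (S := S) (γ := s α * s β * (s (α * β))⁻¹) (by simp)).choose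

theorem inl_factorSet (s : S.Section) (α β : P) :
    S.inl (factorSet s α β) = s α * s β * (s (α * β))⁻¹ :=
  (exists_inl_eq (S := S) (γ := s α * s β * (s (α * β))⁻¹) (by simp)).choose_spec

end sections

/-! ### Extension from G to Γ, prisms, and bounded primitives -/

section U

variable {G Γ P : Type*} [Group G] [Group Γ] [Group P] {V : Type*} [NormedAddCommGroup V]
  [NormedSpace ℝ V] {S : GroupExtension G Γ P}

theorem U.ext_one {u v : U S V 1} (h : ∀ x y, u.1 ![x, y] = v.1 ![x, y]) : u = v := by
  refine Subtype.ext (lp.ext (funext fun x => ?_))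
  have e : x = ![x 0, x 1] := by ext i; fin_cases i <;> rfl
  rw [e]
  exact h _ _

theorem U.ext_two {u v : U S V 2} (h : ∀ x y z, u.1 ![x, y, z] = v.1 ![x, y, z]) : u = v := by
  refine Subtype.ext (lp.ext (funext fun x => ?_))
  have e : x = ![x 0, x 1, x 2] := by ext i; fin_cases i <;> rfl
  rw [e]
  exact h _ _ _

/-- The homogeneous cochain on `Γ` attached to a cochain on `G` and a section. -/
noncomputable def extU (s : S.Section) (n : ℕ) (c : BCochain n G V) : U S V n :=
  ⟨Bdd.mk (fun x => homog (NormedGModule.trivial G V) c fun i => coord s (x i))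
    ⟨‖c‖, fun _ => bdd_norm_le c _⟩, fun g x => by
      simp only [Bdd.mk_apply, coord_inl_mul]
      exact homog_smul (NormedGModule.trivial G V) c g _⟩

theorem extU_apply (s : S.Section) (n : ℕ) (c : BCochain n G V) (x : Fin (n + 1) → Γ) :
    (extU s n c).1 x = homog (NormedGModule.trivial G V) c fun i => coord s (x i) := rfl

theorem norm_extU_le (s : S.Section) (n : ℕ) (c : BCochain n G V) : ‖extU s n c‖ ≤ ‖c‖ :=
  lp.norm_le_of_forall_le (norm_nonneg c) fun _ => bdd_norm_le c _

theorem uDelta_extU (s : S.Section) (n : ℕ) (c : BCochain n G V) :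
    uDelta S V n (extU s n c) = extU s (n + 1) (d (NormedGModule.trivial G V) n c) := by
  ext x
  rw [extU_apply, uDelta_apply]
  change _ = homog _ (dFun (NormedGModule.trivial G V) c) _
  rw [homog_dFun]
  rfl

/-- Restriction to `G` is a left inverse of `extU`, up to conjugation. -/
theorem resU_extU_apply (s : S.Section) (n : ℕ) (c : BCochain n G V) (g : Fin n → G) :
    resU S n (extU s n c) g = c fun i => (coord s 1)⁻¹ * g i * coord s 1 := by
  have h : ∀ g, coord s (S.inl g) = g * coord s 1 := fun g => by
    rw [← coord_inl_mul, mul_one]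
  rw [resU_apply, extU_apply]
  refine congrArg c (funext fun i => ?_)
  have := Fin.partialProd_right_inv g i
  simp only [h]
  rw [← this]
  group

/-- The homotopy between the identity and a `G`-equivariant map `φ : Γ → Γ`, in degree two. -/
noncomputable def prism (φ : Γ → Γ) (hφ : ∀ g x, φ (S.inl g * x) = S.inl g * φ x)
    (u : U S V 2) : U S V 1 :=
  ⟨Bdd.mk (fun x => u.1 ![x 0, φ (x 0), φ (x 1)] - u.1 ![x 0, x 1, φ (x 1)])
    ⟨‖u‖ + ‖u‖, fun _ => (norm_sub_le _ _).trans
      (add_le_add (bdd_norm_le u.1 _) (bdd_norm_le u.1 _))⟩, fun g x => by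
      have h : ∀ a b c, u.1 ![S.inl g * a, S.inl g * b, S.inl g * c] = u.1 ![a, b, c] :=
        fun a b c => by
          rw [← u.2 g ![a, b, c]]
          exact congrArg u.1 (by ext i; fin_cases i <;> rfl)
      simp only [Bdd.mk_apply, hφ, h]⟩

theorem norm_prism_le (φ : Γ → Γ) (hφ : ∀ g x, φ (S.inl g * x) = S.inl g * φ x) (u : U S V 2) :
    ‖prism φ hφ u‖ ≤ 2 * ‖u‖ :=
  lp.norm_le_of_forall_le (by positivity) fun _ => by
    rw [two_mul]
    exact (norm_sub_le _ _).trans (add_le_add (bdd_norm_le u.1 _) (bdd_norm_le u.1 _))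

/-- The prism over the triangle (x, y, z) is cut into the three tetrahedra (x, φx, φy, φz), (x, y,
φy, φz) and (x, y, z, φz); the cocycle condition is applied to each. -/
theorem uDelta_prism (φ : Γ → Γ) (hφ : ∀ g x, φ (S.inl g * x) = S.inl g * φ x) {u : U S V 2}
    (hu : uDelta S V 2 u = 0) (x y z : Γ) :
    (uDelta S V 1 (prism φ hφ u)).1 ![x, y, z] = u.1 ![φ x, φ y, φ z] - u.1 ![x, y, z] := by
  have h : ∀ a b c e, homDelta u.1 ![a, b, c, e] = 0 := fun a b c e => by
    rw [← uDelta_apply, hu]; rfl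
  have h1 := h x (φ x) (φ y) (φ z)
  have h2 := h x y (φ y) (φ z)
  have h3 := h x y z (φ z)
  rw [homDelta_three] at h1 h2 h3
  rw [uDelta_apply, homDelta_two]
  simp only [prism, Bdd.mk_apply, Matrix.cons_val_zero, Matrix.cons_val_one]
  linear_combination (norm := module) h2 - h1 - h3

/-- The map x ↦ `coord s x` retracts Γ equivariantly to G, and a prism joins it to the identity. So
u is the coboundary of the extension of b minus the prism term. The constant is 3 = 1 + 2: ‖b‖ ≤
‖db‖ ≤ ‖u‖, and the prism has norm at most 2‖u‖. -/
theorem exists_uDelta_eq_of_resU_mem {u : U S V 2} (hu : uDelta S V 2 u = 0)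
    (h : resU S 2 u ∈ coboundaries (NormedGModule.trivial G V) 2) :
    ∃ v, uDelta S V 1 v = u ∧ ‖v‖ ≤ 3 * ‖u‖ := by
  obtain ⟨b, hb⟩ := h
  have s : S.Section := ⟨_, Function.rightInverse_surjInv S.rightHom_surjective⟩
  have hφ : ∀ g x, S.inl (coord s (S.inl g * x)) = S.inl g * S.inl (coord s x) := fun g x => by
    rw [coord_inl_mul, map_mul]
  refine ⟨extU s 1 b - prism (fun x => S.inl (coord s x)) hφ u, ?_, ?_⟩
  · rw [map_sub, uDelta_extU, hb]
    refine U.ext_two fun x y z => ?_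
    have h1 := uDelta_prism (fun x => S.inl (coord s x)) hφ hu x y z
    have h2 : (extU s 2 (resU S 2 u)).1 ![x, y, z] =
        u.1 ![S.inl (coord s x), S.inl (coord s y), S.inl (coord s z)] := by
      rw [extU_apply, homog_resU]
      exact congrArg u.1 (by ext i; fin_cases i <;> rfl)
    change (extU s 2 (resU S 2 u)).1 ![x, y, z] -
      (uDelta S V 1 (prism (fun x => S.inl (coord s x)) hφ u)).1 ![x, y, z] = _
    rw [h1, h2]
    abel
  · have h1 := norm_sub_le (extU s 1 b) (prism (fun x => S.inl (coord s x)) hφ u)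
    have h2 := norm_prism_le (fun x => S.inl (coord s x)) hφ u
    have h3 := norm_extU_le s 1 b
    have h4 := norm_le_norm_d_one b
    have h5 : ‖resU S 2 u‖ ≤ ‖u‖ :=
      lp.norm_le_of_forall_le (norm_nonneg u) fun _ => bdd_norm_le u.1 _
    rw [← hb] at h5
    linarith

theorem U.apply_zero_eq {u : U S V 0} (hu : uDelta S V 0 u = 0) (x y : Γ) :
    u.1 ![x] = u.1 ![y] := by
  have : homDelta u.1 ![y, x] = 0 := by rw [← uDelta_apply, hu]; rfl
  rw [homDelta_one] at this
  exact sub_eq_zero.1 this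

theorem exists_constU_eq {u : U S V 0} (hu : uDelta S V 0 u = 0) :
    ∃ v, constU S V v = u ∧ ‖v‖ ≤ ‖u‖ := by
  refine ⟨u.1 ![1], ?_, bdd_norm_le u.1 _⟩
  ext x
  have e : x = ![x 0] := by ext i; fin_cases i; rfl
  rw [constU_apply, e]
  exact U.apply_zero_eq hu _ _

theorem constU_injective : Function.Injective (constU S V) := fun _ _ h =>
  congrArg (fun u : U S V 0 => u.1 ![1]) h

/-- The usual primitive y ↦ u(1, y) has to be G-invariant. Its variation along a G-orbit is g ↦ u(x,
gx), which is a bounded homomorphism and so vanishes. -/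
theorem exists_uDelta_eq_one {u : U S V 1} (hu : uDelta S V 1 u = 0) :
    ∃ v, uDelta S V 0 v = u ∧ ‖v‖ ≤ ‖u‖ := by
  have h : ∀ a b c, u.1 ![b, c] - u.1 ![a, c] + u.1 ![a, b] = 0 := fun a b c => by
    rw [← homDelta_two, ← uDelta_apply, hu]; rfl
  have hG : ∀ (g : G) (a b : Γ), u.1 ![S.inl g * a, S.inl g * b] = u.1 ![a, b] := fun g a b => by
    rw [← u.2 g ![a, b]]
    exact congrArg u.1 (by ext i; fin_cases i <;> rfl)
  have h0 : ∀ (x : Γ) (g : G), u.1 ![x, S.inl g * x] = 0 := fun x g => by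
    refine eq_zero_of_additive_of_bounded (φ := fun g => u.1 ![x, S.inl g * x])
      (fun a b => ?_) (C := ‖u‖) (fun a => bdd_norm_le u.1 _) g
    have h1 := h x (S.inl a * x) (S.inl (a * b) * x)
    rw [map_mul, mul_assoc, hG] at h1
    rw [map_mul, mul_assoc]
    linear_combination (norm := module) (-1 : ℝ) • h1
  refine ⟨⟨Bdd.mk (fun x => u.1 ![1, x 0]) ⟨‖u‖, fun _ => bdd_norm_le u.1 _⟩, fun g x => ?_⟩,
    U.ext_one fun x y => ?_, lp.norm_le_of_forall_le (norm_nonneg u) fun x => bdd_norm_le u.1 _⟩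
  · have h1 := h 1 (x 0) (S.inl g * x 0)
    rw [h0] at h1
    rw [Bdd.mk_apply, Bdd.mk_apply]
    linear_combination (norm := module) (-1 : ℝ) • h1
  · rw [uDelta_apply, homDelta_one]
    have h1 := h 1 x y
    simp only [Bdd.mk_apply, Matrix.cons_val_zero]
    linear_combination (norm := module) (-1 : ℝ) • h1

/-! ### Exactness properties of the columns of the double complex -/

theorem HSK.exists_map_constU_eq {p : ℕ} {x : HSK S V p 0} (hx : Bdd.map (uDelta S V 0) x = 0) :
    ∃ c : BCochain p P V, Bdd.map (constU S V) c = x :=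
  Bdd.exists_map_eq _ _ ‖x‖ fun a =>
    (exists_constU_eq (u := x a) (congrArg (fun y => y.1 a) hx)).imp fun _ h =>
      ⟨h.1, h.2.trans (bdd_norm_le x a)⟩

theorem HSK.exists_map_uDelta_eq_one {p : ℕ} {x : HSK S V p 1}
    (hx : Bdd.map (uDelta S V 1) x = 0) : ∃ y : HSK S V p 0, Bdd.map (uDelta S V 0) y = x :=
  Bdd.exists_map_eq _ _ ‖x‖ fun a =>
    (exists_uDelta_eq_one (u := x a) (congrArg (fun y => y.1 a) hx)).imp fun _ h =>
      ⟨h.1, h.2.trans (bdd_norm_le x a)⟩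

theorem HSK.exists_map_uDelta_eq_two {p : ℕ} {x : HSK S V p 2}
    (hx : Bdd.map (uDelta S V 2) x = 0)
    (h : ∀ a, resU S 2 (x a) ∈ coboundaries (NormedGModule.trivial G V) 2) :
    ∃ y : HSK S V p 1, Bdd.map (uDelta S V 1) y = x :=
  Bdd.exists_map_eq _ _ (3 * ‖x‖) fun a =>
    (exists_uDelta_eq_of_resU_mem (u := x a) (congrArg (fun y => y.1 a) hx) (h a)).imp
      fun _ h => ⟨h.1, h.2.trans (by linarith [bdd_norm_le x a])⟩

end U

/-! ### Cycles and boundaries of the terms E₃^{0,2} and E₃^{3,0} of a double complex -/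

namespace DoubleComplex

variable {K : ℕ → ℕ → Type*} [∀ p q, AddCommGroup (K p q)] [∀ p q, Module ℝ (K p q)]
  (C : DoubleComplex K)

/-- The element of degree one of the total complex with given components. -/
def ofDegreeOne (a : K 0 1) (b : K 1 0) : ∀ p q, K p q
  | 0, 1 => a
  | 1, 0 => b
  | _, _ => 0

/-- The element of degree two of the total complex with given components. -/
def ofDegreeTwo (a : K 0 2) (b : K 1 1) (c : K 2 0) : ∀ p q, K p q
  | 0, 2 => a
  | 1, 1 => b
  | 2, 0 => c
  | _, _ => 0

theorem ofDegreeOne_mem_gr (a : K 0 1) (b : K 1 0) : ofDegreeOne a b ∈ C.total.gr 1 := by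
  intro p q h
  rcases p with _ | _ | p <;> rcases q with _ | _ | q <;> first | rfl | simp at h

theorem ofDegreeTwo_mem_gr (a : K 0 2) (b : K 1 1) (c : K 2 0) :
    ofDegreeTwo a b c ∈ C.total.gr 2 := by
  intro p q h
  rcases p with _ | _ | _ | p <;> rcases q with _ | _ | _ | q <;> first | rfl | simp at h

theorem mem_F_one_of_mem_gr {n : ℕ} {x : ∀ p q, K p q} (hx : x ∈ C.total.gr n) (h : x 0 n = 0) :
    x ∈ C.total.F 1 := by
  intro p q hp
  obtain rfl : p = 0 := by omega
  by_cases hq : q = n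
  · rw [hq, h]
  · exact hx 0 q (by simpa using hq)

/-- Dx has degree 3, so the condition is the vanishing of its components at (0,3), (1,2) and (2,1).
The sign (-1)^p in D turns the second into an equality and leaves a sum in the third. -/
theorem D_mem_F_three_iff {x : ∀ p q, K p q} (hx : x ∈ C.total.gr 2) :
    C.total.D x ∈ C.total.F 3 ↔ C.dv 0 2 (x 0 2) = 0 ∧ C.dh 0 2 (x 0 2) = C.dv 1 1 (x 1 1) ∧
      C.dh 1 1 (x 1 1) + C.dv 2 0 (x 2 0) = 0 := by
  have e1 : C.totD x 0 3 = C.dv 0 2 (x 0 2) := C.totD_zero_succ x 2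
  have e2 : C.totD x 1 2 = C.dh 0 2 (x 0 2) - C.dv 1 1 (x 1 1) := by
    rw [C.totD_succ_succ x 0 1]; simp [sub_eq_add_neg]
  have e3 : C.totD x 2 1 = C.dh 1 1 (x 1 1) + C.dv 2 0 (x 2 0) := by
    rw [C.totD_succ_succ x 1 0]; simp
  rw [← e1, ← e3, ← sub_eq_zero (a := C.dh 0 2 (x 0 2)), ← e2]
  refine ⟨fun h => ⟨h 0 3 (by norm_num), h 1 2 (by norm_num), h 2 1 (by norm_num)⟩,
    fun h p q hp => ?_⟩
  have hg := C.total.D_gr 2 x hx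
  by_cases hpq : (p : ℤ) + q = 2 + 1
  · have hp' : p < 3 := by omega
    interval_cases p
    · obtain rfl : q = 3 := by omega
      exact h.1
    · obtain rfl : q = 2 := by omega
      exact h.2.1
    · obtain rfl : q = 1 := by omega
      exact h.2.2
  · exact hg p q hpq

theorem mem_Z_three_zero_two_iff {x : ∀ p q, K p q} :
    x ∈ C.total.Z 3 0 2 ↔ x ∈ C.total.gr 2 ∧ C.dv 0 2 (x 0 2) = 0 ∧
      C.dh 0 2 (x 0 2) = C.dv 1 1 (x 1 1) ∧ C.dh 1 1 (x 1 1) + C.dv 2 0 (x 2 0) = 0 := by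
  constructor
  · exact fun h => ⟨h.1.2, (C.D_mem_F_three_iff h.1.2).1 h.2.1⟩
  · refine fun h => ⟨⟨?_, h.1⟩, (C.D_mem_F_three_iff h.1).2 h.2, C.total.D_gr 2 x h.1⟩
    rw [C.total.F_nonpos 0 le_rfl]
    trivial

/-- An element of `Z₃^{0,2}` whose component in `K^{0,2}` is a vertical coboundary vanishes in
`E₃^{0,2}`. -/
theorem mem_of_dv_eq {x : ∀ p q, K p q} (hx : x ∈ C.total.Z 3 0 2) {y : K 0 1}
    (hy : C.dv 0 1 y = x 0 2) :
    x ∈ C.total.Z (3 - 1) (0 + 1) (2 - 1) ⊔ C.total.B (3 - 1) 0 2 := by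
  -- Dw and x have the same (0,2)-component, so x - Dw lies in F¹ and has the same differential as
  -- x. Dw itself lies in B₂^{0,2}, because the filtration is everything in nonpositive degrees.
  set w : ∀ p q, K p q := ofDegreeOne y 0
  have hw : w ∈ C.total.gr 1 := C.ofDegreeOne_mem_gr y 0
  have hDw : C.total.D w ∈ C.total.gr 2 := C.total.D_gr 1 w hw
  have h0 : C.totD w 0 2 = x 0 2 := (C.totD_zero_succ w 1).trans hy
  have hz : x - C.total.D w ∈ C.total.gr 2 := sub_mem hx.1.2 hDw
  refine Submodule.mem_sup.2 ⟨x - C.total.D w, ⟨⟨?_, ?_⟩, ?_⟩, C.total.D w, ⟨⟨?_, ?_⟩, w, ⟨?_, ?_⟩, rfl⟩,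
    sub_add_cancel _ _⟩
  · exact C.mem_F_one_of_mem_gr hz (sub_eq_zero.2 h0.symm)
  · exact hz
  · change C.total.D (x - C.total.D w) ∈ C.total.FK _ _
    rw [map_sub, C.total.D_D, sub_zero]
    exact hx.2
  · rw [C.total.F_nonpos 0 le_rfl]; trivial
  · exact hDw
  · rw [C.total.F_nonpos _ (by norm_num)]; trivial
  · exact hw

theorem eq_edge_of_mem_FK {p : ℕ} {x : ∀ p q, K p q} (hx : x ∈ C.total.FK p p) :
    x = edge p (x p 0) := by
  funext i j
  by_cases h : i = p ∧ j = 0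
  · obtain ⟨rfl, rfl⟩ := h
    rw [edge_zero]
  · rw [edge_ne p _ (by tauto)]
    by_cases h' : (i : ℤ) < p
    · exact hx.1 i j h'
    · exact hx.2 i j (by omega)

/-- The elements of `Z₃^{3,0}` are the elements of `K^{3,0}` killed by both differentials. -/
theorem eq_edge_of_mem_Z_three {x : ∀ p q, K p q} (hx : x ∈ C.total.Z 3 3 0) :
    x = edge 3 (x 3 0) ∧ C.dv 3 0 (x 3 0) = 0 ∧ C.dh 3 0 (x 3 0) = 0 := by
  -- Dx lies in F⁶ in degree 4, and this is zero because q ≥ 0.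
  have hD : C.totD x = 0 := by
    funext p q
    by_cases h : (p : ℤ) < 3 + 3
    · exact hx.2.1 p q h
    · exact hx.2.2 p q (by omega)
  have e1 : C.totD x 4 0 = C.dh 3 0 (x 3 0) := C.totD_succ_zero x 3
  have e2 : C.totD x 3 1 = C.dh 2 1 (x 2 1) + (-1 : ℝ) ^ 3 • C.dv 3 0 (x 3 0) :=
    C.totD_succ_succ x 2 0
  have h21 : x 2 1 = 0 := hx.1.1 2 1 (by norm_num)
  rw [hD, Pi.zero_apply, Pi.zero_apply] at e1 e2
  refine ⟨C.eq_edge_of_mem_FK (p := 3) hx.1, ?_, e1.symm⟩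
  rw [h21, map_zero, zero_add] at e2
  exact (smul_eq_zero.1 e2.symm).resolve_left (by norm_num)

/-- If an element of `K^{3,0}` vanishes in `E₃^{3,0}`, then it is the total coboundary of an element
of `K^{1,1} ⊕ K^{2,0}`. -/
theorem exists_of_edge_mem {c : K 3 0}
    (hc : edge 3 c ∈ C.total.Z (3 - 1) (3 + 1) (0 - 1) ⊔ C.total.B (3 - 1) 3 0) :
    ∃ (a : K 1 1) (b : K 2 0), C.dv 1 1 a = 0 ∧ C.dh 1 1 a + C.dv 2 0 b = 0 ∧ C.dh 2 0 b = c := by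
  obtain ⟨z, hz, _, ⟨h1, w, hw, rfl⟩, h⟩ := Submodule.mem_sup.1 hc
  -- Z₂^{4,-1} is contained in F⁴ in degree 3, which is zero.
  have hz0 : z = 0 := by
    funext p q
    by_cases h : (p : ℤ) < 3 + 1
    · exact hz.1.1 p q h
    · exact hz.1.2 p q (by omega)
  rw [hz0, zero_add] at h
  have h' : C.totD w = edge 3 c := h
  have e1 : C.totD w 1 2 = C.dh 0 2 (w 0 2) + (-1 : ℝ) ^ 1 • C.dv 1 1 (w 1 1) :=
    C.totD_succ_succ w 0 1
  have e2 : C.totD w 2 1 = C.dh 1 1 (w 1 1) + (-1 : ℝ) ^ 2 • C.dv 2 0 (w 2 0) :=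
    C.totD_succ_succ w 1 0
  have e3 : C.totD w 3 0 = C.dh 2 0 (w 2 0) := C.totD_succ_zero w 2
  -- Here w lies in F^{3-2} = F¹.
  have h02 : w 0 2 = 0 := hw.1 0 2 (by norm_num)
  rw [h', edge_ne 3 c (Or.inl (by norm_num))] at e1 e2
  rw [h', edge_zero] at e3
  refine ⟨w 1 1, w 2 0, ?_, ?_, e3.symm⟩
  · rw [h02, map_zero, zero_add] at e1
    exact (smul_eq_zero.1 e1.symm).resolve_left (by norm_num)
  · rw [e2]; simp

end DoubleComplex

/-! ### Identification of E₃^{0,2} and E₃^{3,0} -/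

section HochschildSerre

variable {G Γ P : Type*} [Group G] [Group Γ] [Group P] {V : Type*} [NormedAddCommGroup V]
  [NormedSpace ℝ V] (S : GroupExtension G Γ P) (N : NormedGModule P V)

theorem HB.mk_eq_iff {M : NormedGModule G V} {n : ℕ} {c c' : BCochain n G V}
    {h : c ∈ cocycles M n} {h' : c' ∈ cocycles M n} :
    HB.mk M n c h = HB.mk M n c' h' ↔ c - c' ∈ coboundaries M n :=
  Submodule.Quotient.eq _

theorem res_mk {x : ∀ p q, HSK S V p q} (hx : x ∈ (hs S N).Z 3 0 2) :
    res S N (Submodule.Quotient.mk ⟨x, hx⟩) =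
      HB.mk (NormedGModule.trivial G V) 2 (resTot S x) (resTot_mem S N hx) := rfl

/-- If the restriction to G is a coboundary, then the (0,2)-component is a vertical coboundary, and
such an element is zero in E₃^{0,2}. -/
theorem res_injective : Function.Injective (res S N) := by
  rw [injective_iff_map_eq_zero]
  intro e he
  obtain ⟨⟨x, hx⟩, rfl⟩ := Submodule.Quotient.mk_surjective _ e
  have h1 : resTot S x ∈ coboundaries (NormedGModule.trivial G V) 2 :=
    (Submodule.Quotient.mk_eq_zero ((coboundaries (NormedGModule.trivial G V) 2).submoduleOf
      (cocycles (NormedGModule.trivial G V) 2))).1 he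
  have hx' := (hsDouble S N).mem_Z_three_zero_two_iff.1 hx
  obtain ⟨y, hy⟩ := HSK.exists_map_uDelta_eq_two (x := x 0 2) hx'.2.1 fun a => by
    rw [Subsingleton.elim a Fin.elim0]; exact h1
  exact (Submodule.Quotient.mk_eq_zero _).2 ((hsDouble S N).mem_of_dv_eq hx hy)

theorem uDelta_uAct {q : ℕ} (γ : Γ) {u : U S V q} (hu : uDelta S V q u = 0) :
    uDelta S V q (uAct S N q γ u) = 0 := by
  rw [← uModule_rep, uDelta_rep, hu, map_zero]

/-- The action of `γ` on cochains of `G` is the restriction of its action on `U²`, up to an explicit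
coboundary. -/
theorem conjCochain_resU (γ : Γ) {u : U S V 2} (hu : uDelta S V 2 u = 0) :
    conjCochain S N 2 γ (resU S 2 u) - resU S 2 (uAct S N 2 γ u) ∈
      coboundaries (NormedGModule.trivial G V) 2 := by
  have hφ : ∀ (g : G) (x : Γ), S.inl g * x * γ = S.inl g * (x * γ) := fun g x => mul_assoc _ _ _
  -- Right translation by γ commutes with left translation by G, and (γu)(xγ) = γ u(γ⁻¹xγ). The
  -- prism between x and xγ thus compares γu with the conjugation action.
  refine ⟨resU S 1 (prism (· * γ) hφ (uAct S N 2 γ u)), ?_⟩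
  rw [d_resU]
  ext g
  have h := uDelta_prism (· * γ) hφ (uDelta_uAct S N γ hu) (S.inl (Fin.partialProd g 0))
    (S.inl (Fin.partialProd g 1)) (S.inl (Fin.partialProd g 2))
  have e : ∀ F : Γ → Γ, (fun i : Fin 3 => F (S.inl (Fin.partialProd g i))) =
      ![F (S.inl (Fin.partialProd g 0)), F (S.inl (Fin.partialProd g 1)),
        F (S.inl (Fin.partialProd g 2))] := fun F => by
    ext i; fin_cases i <;> rfl
  have e1 : (fun i : Fin 3 => S.inl (Fin.partialProd (fun j => S.conjAct γ⁻¹ (g j)) i)) =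
      fun i => γ⁻¹ * (S.inl (Fin.partialProd g i) * γ) := by
    funext i
    have hp : Fin.partialProd (fun j => S.conjAct γ⁻¹ (g j)) i =
        S.conjAct γ⁻¹ (Fin.partialProd g i) := by
      induction i using Fin.induction with
      | zero => simp
      | succ i ih => rw [Fin.partialProd_succ, ih, Fin.partialProd_succ, map_mul]
    rw [hp, S.inl_conjAct_comm]
    group
  change (uDelta S V 1 _).1 (fun i => S.inl (Fin.partialProd g i)) =
    conjCochain S N 2 γ (resU S 2 u) g - resU S 2 (uAct S N 2 γ u) g
  rw [e fun x => x, h, ← e fun x => x, ← e (· * γ), conjCochain_apply, resU_apply, resU_apply,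
    uAct_apply, e1]

theorem conjHB_mk (γ : Γ) {c : BCochain 2 G V} (hc : c ∈ cocycles (NormedGModule.trivial G V) 2) :
    conjHB S N γ (HB.mk _ 2 c hc) = HB.mk _ 2 c hc ↔
      conjCochain S N 2 γ c - c ∈ coboundaries (NormedGModule.trivial G V) 2 :=
  Submodule.Quotient.eq _

/-- The relation between the (0,2)- and (1,1)-components of a cycle says that translating the former
by any γ changes it by a coboundary, which gives invariance. Conversely, the components of a cycle
over an invariant class are constructed in turn. The (1,1)-component needs the invariance and the
uniform bound on primitives in degree 2; the (2,0)-component needs only the exactness of U in degree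
1. -/
theorem range_res : LinearMap.range (res S N) = invariants S N := by
  refine le_antisymm ?_ fun e he => ?_
  · rintro _ ⟨e, rfl⟩
    obtain ⟨⟨x, hx⟩, rfl⟩ := Submodule.Quotient.mk_surjective _ e
    obtain ⟨-, h1, h2, -⟩ := (hsDouble S N).mem_Z_three_zero_two_iff.1 hx
    rw [mem_invariants]
    intro γ
    rw [res_mk, conjHB_mk]
    have h3 : uDelta S V 2 (x 0 2 Fin.elim0) = 0 := congrArg (fun y => y.1 Fin.elim0) h1
    have h4 : d (uModule S N 2) 0 (x 0 2) ![S.rightHom γ] =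
        uDelta S V 1 (x 1 1 ![S.rightHom γ]) := congrArg (fun y => y.1 ![S.rightHom γ]) h2
    rw [d_zero_apply] at h4
    change (uModule S N 2).rep (S.rightHom γ) _ - _ = _ at h4
    rw [uModule_rep] at h4
    have h5 := conjCochain_resU S N γ h3
    have h6 : resU S 2 (uAct S N 2 γ (x 0 2 Fin.elim0)) - resU S 2 (x 0 2 Fin.elim0) ∈
        coboundaries (NormedGModule.trivial G V) 2 := by
      rw [← map_sub, h4, ← d_resU]
      exact ⟨_, rfl⟩
    have h7 := add_mem h5 h6
    rwa [sub_add_sub_cancel] at h7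
  · obtain ⟨⟨c, hc⟩, rfl⟩ := Submodule.Quotient.mk_surjective _ e
    rw [mem_invariants] at he
    have he' := fun γ => (conjHB_mk S N γ hc).1 (he γ)
    obtain ⟨s, hs1⟩ := exists_section_map_one S
    have hres : resU S 2 (extU s 2 c) = c := by
      ext g
      rw [resU_extU_apply, hs1]
      simp
    have hu : uDelta S V 2 (extU s 2 c) = 0 := by
      rw [uDelta_extU, LinearMap.mem_ker.1 hc]; rfl
    set x₀ : HSK S V 0 2 := Bdd.mk (fun _ => extU s 2 c) ⟨_, fun _ => le_rfl⟩ with hx₀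
    have h0 : (hsDouble S N).dv 0 2 x₀ = 0 := lp.ext (funext fun _ => hu)
    have h0' : Bdd.map (uDelta S V 2) ((hsDouble S N).dh 0 2 x₀) = 0 := by
      refine ((hsDouble S N).dv_dh 0 2 x₀).trans ?_
      rw [h0, map_zero]
    -- Invariance enters here: each value of the horizontal differential of x₀ is γu - u for the
    -- extension u of c, and it restricts to a coboundary on G.
    obtain ⟨x₁, hx₁⟩ := HSK.exists_map_uDelta_eq_two h0' fun a => by
      obtain ⟨γ, hγ⟩ := S.rightHom_surjective (a 0)
      have h1 : (hsDouble S N).dh 0 2 x₀ a = uAct S N 2 γ (extU s 2 c) - extU s 2 c := by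
        refine (d_zero_apply (uModule S N 2) x₀ a).trans ?_
        rw [← hγ, uModule_rep]
        rfl
      rw [h1, map_sub]
      have h2 := conjCochain_resU S N γ hu
      have h3 := sub_mem (he' γ) h2
      rw [hres] at h3 ⊢
      simpa using h3
    have h1' : Bdd.map (uDelta S V 1) ((hsDouble S N).dh 1 1 x₁) = 0 := by
      refine ((hsDouble S N).dv_dh 1 1 x₁).trans ?_
      have : (hsDouble S N).dv 1 1 x₁ = (hsDouble S N).dh 0 2 x₀ := hx₁
      rw [this, (hsDouble S N).dh_dh]
    obtain ⟨x₂, hx₂⟩ := HSK.exists_map_uDelta_eq_one h1'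
    have hZ : DoubleComplex.ofDegreeTwo x₀ x₁ (-x₂) ∈ (hs S N).Z 3 0 2 := by
      refine (hsDouble S N).mem_Z_three_zero_two_iff.2
        ⟨(hsDouble S N).ofDegreeTwo_mem_gr _ _ _, h0, hx₁.symm, ?_⟩
      change (hsDouble S N).dh 1 1 x₁ + (hsDouble S N).dv 2 0 (-x₂) = 0
      have : (hsDouble S N).dv 2 0 x₂ = (hsDouble S N).dh 1 1 x₁ := hx₂
      rw [map_neg, this, add_neg_cancel]
    refine ⟨Submodule.Quotient.mk ⟨_, hZ⟩, ?_⟩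
    rw [res_mk]
    refine HB.mk_eq_iff.2 ?_
    have : resTot S (DoubleComplex.ofDegreeTwo x₀ x₁ (-x₂)) = c := hres
    rw [this, sub_self]
    exact zero_mem _

/-- A bounding element has components a in K^{1,1} and b in K^{2,0}. Exactness in row 1 writes a as
the vertical coboundary of some w. Then b plus the horizontal coboundary of w is killed vertically,
hence takes constant values, and it is a primitive of c over Π. -/
theorem infl_injective : Function.Injective (infl S N) := by
  rw [injective_iff_map_eq_zero]
  intro e he
  obtain ⟨⟨c, hc⟩, rfl⟩ := Submodule.Quotient.mk_surjective _ e
  have h1 := (Submodule.Quotient.mk_eq_zero _).1 he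
  obtain ⟨a, b, ha, hab, hb⟩ := (hsDouble S N).exists_of_edge_mem h1
  obtain ⟨w, hw⟩ := HSK.exists_map_uDelta_eq_one ha
  have hw' : (hsDouble S N).dv 1 0 w = a := hw
  obtain ⟨b', hb'⟩ := HSK.exists_map_constU_eq (x := (hsDouble S N).dh 1 0 w + b) (by
    change (hsDouble S N).dv 2 0 _ = 0
    rw [map_add, (hsDouble S N).dv_dh, hw', hab])
  refine (Submodule.Quotient.mk_eq_zero _).2 ⟨b', ?_⟩
  have h2 : Bdd.map (constU S V) (d N 2 b') = Bdd.map (constU S V) c := by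
    rw [← d_map _ _ _ (constU_rep S N) 2 b', hb']
    change (hsDouble S N).dh 2 0 _ = _
    rw [map_add, (hsDouble S N).dh_dh, hb, zero_add]
    rfl
  exact lp.ext (funext fun x => constU_injective (congrArg (fun y => y.1 x) h2))

/-- An element of Z₃^{3,0} sits in K^{3,0} and is killed by both differentials. The vertical one
makes its values constant functions; the horizontal one then makes it a cocycle. -/
theorem infl_surjective : Function.Surjective (infl S N) := by
  intro e
  obtain ⟨⟨x, hx⟩, rfl⟩ := Submodule.Quotient.mk_surjective _ e
  obtain ⟨h1, h2, h3⟩ := (hsDouble S N).eq_edge_of_mem_Z_three hx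
  obtain ⟨c, hc⟩ := HSK.exists_map_constU_eq h2
  have hc' : c ∈ cocycles N 3 := by
    refine LinearMap.mem_ker.2 (lp.ext (funext fun a => constU_injective (S := S) ?_))
    have h4 : Bdd.map (constU S V) (d N 3 c) = 0 := by
      rw [← d_map _ _ _ (constU_rep S N) 3 c, hc]
      exact h3
    exact congrArg (fun y => y.1 a) h4
  refine ⟨HB.mk N 3 c hc', ?_⟩
  refine congrArg Submodule.Quotient.mk (Subtype.ext ?_)
  change DoubleComplex.edge 3 (Bdd.map (constU S V) c) = x
  rw [hc, ← h1]

end HochschildSerre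

/-! ### The obstruction cocycle of a factor set -/

section factorSet

variable {G Γ P : Type*} [Group G] [Group Γ] [Group P] {S : GroupExtension G Γ P}

theorem redModule_outerAction_rep (γ : Γ) :
    (redModule (outerAction S)).rep (S.rightHom γ) = redMap (S.conjAct γ) := by
  change (outModule G).rep (outerAction S (S.rightHom γ)) = _
  rw [outerAction_rightHom, outModule_rep]

/-- Associativity in Γ: both sides are s(α)s(β)s(δ)s(αβδ)⁻¹. -/
theorem factorSet_mul (s : S.Section) (α β δ : P) :
    S.conjAct (s α) (factorSet s β δ) * factorSet s α (β * δ) =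
      factorSet s α β * factorSet s (α * β) δ := by
  apply S.inl_injective
  simp only [map_mul, S.inl_conjAct_comm, inl_factorSet, mul_assoc α β δ]
  group

theorem conjAct_conjAct (s : S.Section) (α β : P) (g : G) :
    S.conjAct (s α) (S.conjAct (s β) g) =
      factorSet s α β * S.conjAct (s (α * β)) g * (factorSet s α β)⁻¹ := by
  apply S.inl_injective
  simp only [map_mul, map_inv, S.inl_conjAct_comm, inl_factorSet]
  group

/-- If x lies over ξ, then s(α)⁻¹x lies over α⁻¹ξ, and s(α)s(α⁻¹ξ) = f(α, α⁻¹ξ)s(ξ). -/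
theorem conjAct_coord (s : S.Section) (α : P) (x : Γ) :
    S.conjAct (s α) (coord s ((s α)⁻¹ * x)) =
      coord s x * (factorSet s α (α⁻¹ * S.rightHom x))⁻¹ := by
  apply S.inl_injective
  simp only [map_mul, map_inv, S.inl_conjAct_comm, inl_factorSet, inl_coord,
    s.rightHom_section, mul_inv_cancel_left]
  group

/-- The `3`-cochain `(α, β, δ) ↦ m̄₂(s(α) f(β, δ) s(α)⁻¹, f(α, βδ)) - m̄₂(f(α, β), f(αβ, δ))` of the
factor set of a section. -/
noncomputable def obstruction (s : S.Section) (α β δ : P) : RedH2 G :=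
  m₂bar (S.conjAct (s α) (factorSet s β δ)) (factorSet s α (β * δ)) -
    m₂bar (factorSet s α β) (factorSet s (α * β) δ)

theorem norm_obstruction_le (s : S.Section) (α β δ : P) : ‖obstruction s α β δ‖ ≤ 8 :=
  (norm_sub_le _ _).trans ((add_le_add (norm_m₂bar_le _ _) (norm_m₂bar_le _ _)).trans
    (by norm_num))

/-- Naturality turns the left side into values of m̄₂ only, and the relations of the factor set
match their arguments. Six cocycle identities then nearly suffice; as s(α)s(β) and s(αβ) act
differently, by conjugation with t = f(α, β), the swap identity is needed once. -/
theorem obstruction_cocycle (s : S.Section) (α β δ ε : P) :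
    redMap (S.conjAct (s α)) (obstruction s β δ ε) - obstruction s (α * β) δ ε +
      obstruction s α (β * δ) ε - obstruction s α β (δ * ε) + obstruction s α β δ = 0 := by
  have r1 := conjAct_conjAct s α β (factorSet s δ ε)
  have r2 := congrArg (S.conjAct (s α)) (factorSet_mul s β δ ε)
  have r3 := factorSet_mul s (α * β) δ ε
  have r4 := factorSet_mul s α (β * δ) ε
  have r5 := factorSet_mul s α β (δ * ε)
  have r6 := factorSet_mul s α β δ
  simp only [obstruction, map_sub, redMap_m₂bar]
  rw [map_mul, map_mul] at r2
  rw [mul_assoc β δ ε, ← mul_assoc α β δ] at r4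
  rw [← mul_assoc α β δ, mul_assoc β δ ε]
  rw [r1] at r2 ⊢
  set t := factorSet s α β
  set B := S.conjAct (s (α * β)) (factorSet s δ ε)
  set a₂ := S.conjAct (s α) (factorSet s β (δ * ε))
  set a₃ := S.conjAct (s α) (factorSet s β δ)
  set a₄ := S.conjAct (s α) (factorSet s (β * δ) ε)
  set b₂ := factorSet s (α * β) (δ * ε)
  set b₃ := factorSet s (α * β) δ
  set b₄ := factorSet s (α * β * δ) ε
  set e₂ := factorSet s α (β * (δ * ε))
  set e₃ := factorSet s α (β * δ)
  have h0 := m₂bar_conj_swap t B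
  have h1 := m₂bar_cocycle (t * B * t⁻¹) a₂ e₂
  have h2 := m₂bar_cocycle a₃ a₄ e₂
  have h3 := m₂bar_cocycle a₃ e₃ b₄
  have h4 := m₂bar_cocycle t b₃ b₄
  have h5 := m₂bar_cocycle t B b₂
  have h6 := m₂bar_cocycle (t * B * t⁻¹) t b₂
  rw [r5, r2] at h1
  rw [r4] at h2
  rw [r6] at h3
  rw [← r3] at h4
  rw [inv_mul_cancel_right] at h6
  linear_combination (norm := module) h0 + h1 - h2 + h3 - h4 + h5 - h6

end factorSet

/-! ### A cocycle-level lift of the class `g₂` -/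

section lift

variable {G Γ P : Type*} [Group G] [Group Γ] [Group P] {S : GroupExtension G Γ P}

theorem extU_m₂Cochain_apply (s : S.Section) (x y z : Γ) :
    (extU s 2 (m₂Cochain G)).1 ![x, y, z] =
      m₂bar ((coord s x)⁻¹ * coord s y) ((coord s y)⁻¹ * coord s z) := rfl

theorem rightHom_inl_mul (g : G) (x : Γ) : S.rightHom (S.inl g * x) = S.rightHom x := by simp

/-- A primitive in `U¹` of the difference between the homogeneous cochain of `m₂bar` and its
translate by `s(α)`. -/
noncomputable def liftOne (s : S.Section) (α : P) : U S (RedH2 G) 1 :=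
  ⟨Bdd.mk (fun x =>
    m₂bar (factorSet s α (α⁻¹ * S.rightHom (x 0)) * ((coord s (x 0))⁻¹ * coord s (x 1)) *
        (factorSet s α (α⁻¹ * S.rightHom (x 1)))⁻¹) (factorSet s α (α⁻¹ * S.rightHom (x 1))) -
      m₂bar (factorSet s α (α⁻¹ * S.rightHom (x 0))) ((coord s (x 0))⁻¹ * coord s (x 1)))
    ⟨4 + 4, fun _ => (norm_sub_le _ _).trans (add_le_add (norm_m₂bar_le _ _) (norm_m₂bar_le _ _))⟩,
    fun g x => by
      have e : (g * coord s (x 0))⁻¹ * (g * coord s (x 1)) = (coord s (x 0))⁻¹ * coord s (x 1) := by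
        group
      simp only [Bdd.mk_apply, rightHom_inl_mul, coord_inl_mul, e]⟩

theorem liftOne_apply (s : S.Section) (α : P) (x y : Γ) : (liftOne s α).1 ![x, y] =
    m₂bar (factorSet s α (α⁻¹ * S.rightHom x) * ((coord s x)⁻¹ * coord s y) *
        (factorSet s α (α⁻¹ * S.rightHom y))⁻¹) (factorSet s α (α⁻¹ * S.rightHom y)) -
      m₂bar (factorSet s α (α⁻¹ * S.rightHom x)) ((coord s x)⁻¹ * coord s y) := rfl

theorem norm_liftOne_le (s : S.Section) (α : P) : ‖liftOne s α‖ ≤ 4 + 4 :=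
  lp.norm_le_of_forall_le (by norm_num) fun _ =>
    (norm_sub_le _ _).trans (add_le_add (norm_m₂bar_le _ _) (norm_m₂bar_le _ _))

/-- The element `x ↦ -θ(α, β, (αβ)⁻¹σ(x))` of `U⁰`, for the obstruction cocycle `θ` of `s`. -/
noncomputable def liftTwo (s : S.Section) (α β : P) : U S (RedH2 G) 0 :=
  ⟨Bdd.mk (fun x => -obstruction s α β ((α * β)⁻¹ * S.rightHom (x 0)))
    ⟨8, fun _ => by rw [norm_neg]; exact norm_obstruction_le _ _ _ _⟩,
    fun g x => by simp only [Bdd.mk_apply, rightHom_inl_mul]⟩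

theorem liftTwo_apply (s : S.Section) (α β : P) (x : Fin 1 → Γ) :
    (liftTwo s α β).1 x = -obstruction s α β ((α * β)⁻¹ * S.rightHom (x 0)) := rfl

theorem norm_liftTwo_le (s : S.Section) (α β : P) : ‖liftTwo s α β‖ ≤ 8 :=
  lp.norm_le_of_forall_le (by norm_num) fun _ => by
    refine (norm_neg _).trans_le ?_
    exact norm_obstruction_le _ _ _ _

theorem conjAct_coord_inv_mul (s : S.Section) (α : P) (x y : Γ) :
    S.conjAct (s α) ((coord s ((s α)⁻¹ * x))⁻¹ * coord s ((s α)⁻¹ * y)) =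
      factorSet s α (α⁻¹ * S.rightHom x) * ((coord s x)⁻¹ * coord s y) *
        (factorSet s α (α⁻¹ * S.rightHom y))⁻¹ := by
  rw [map_mul, map_inv, conjAct_coord, conjAct_coord]
  group

theorem uModule_section_rep_apply (s : S.Section) (α : P) {q : ℕ} (u : U S (RedH2 G) q)
    (x : Fin (q + 1) → Γ) : ((uModule S (redModule (outerAction S)) q).rep α u).1 x =
      redMap (S.conjAct (s α)) (u.1 fun i => (s α)⁻¹ * x i) := by
  rw [← redModule_outerAction_rep, ← uAct_apply, ← uModule_rep, s.rightHom_section]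

/-- Translation by s(α) moves the vertices h of the cochain m̄₂ to hp⁻¹, where p is a value of the
factor set. `liftOne` is the prism between these two sets of vertices, and its three tetrahedra give
the three cocycle identities. -/
theorem uDelta_liftOne (s : S.Section) (α : P) :
    uDelta S (RedH2 G) 1 (liftOne s α) =
      (uModule S (redModule (outerAction S)) 2).rep α (extU s 2 (m₂Cochain G)) -
        extU s 2 (m₂Cochain G) := by
  refine U.ext_two fun x y z => ?_
  change _ = ((uModule S (redModule (outerAction S)) 2).rep α (extU s 2 (m₂Cochain G))).1 _ -
    (extU s 2 (m₂Cochain G)).1 _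
  have e : (fun i => (s α)⁻¹ * (![x, y, z] : Fin 3 → Γ) i) =
      ![(s α)⁻¹ * x, (s α)⁻¹ * y, (s α)⁻¹ * z] := by ext i; fin_cases i <;> rfl
  rw [uModule_section_rep_apply s, e, extU_m₂Cochain_apply, extU_m₂Cochain_apply, redMap_m₂bar,
    conjAct_coord_inv_mul, conjAct_coord_inv_mul, uDelta_apply, homDelta_two]
  simp only [liftOne_apply]
  have e' : (coord s x)⁻¹ * coord s z =
      ((coord s x)⁻¹ * coord s y) * ((coord s y)⁻¹ * coord s z) := by group
  rw [e']
  generalize (coord s x)⁻¹ * coord s y = g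
  generalize (coord s y)⁻¹ * coord s z = h
  generalize factorSet s α (α⁻¹ * S.rightHom x) = p
  generalize factorSet s α (α⁻¹ * S.rightHom y) = q
  generalize factorSet s α (α⁻¹ * S.rightHom z) = w
  have h1 := m₂bar_cocycle p g h
  have h2 := m₂bar_cocycle (p * g * q⁻¹) q h
  have h3 := m₂bar_cocycle (p * g * q⁻¹) (q * h * w⁻¹) w
  have e1 : p * g * q⁻¹ * (q * h * w⁻¹) = p * (g * h) * w⁻¹ := by group
  rw [inv_mul_cancel_right] at h2 h3
  rw [e1] at h3
  linear_combination (norm := module) h2 - h1 - h3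

/-- The prisms for β and α, stacked, are compared with the prism for αβ. They differ by terms
attached to the single vertices x and y, which are the obstruction at these vertices. -/
theorem rep_liftOne (s : S.Section) (α β : P) :
    (uModule S (redModule (outerAction S)) 1).rep α (liftOne s β) - liftOne s (α * β) +
      liftOne s α + uDelta S (RedH2 G) 0 (liftTwo s α β) = 0 := by
  refine U.ext_one fun x y => ?_
  change ((uModule S (redModule (outerAction S)) 1).rep α (liftOne s β)).1 _ -
    (liftOne s (α * β)).1 _ + (liftOne s α).1 _ + (uDelta S (RedH2 G) 0 (liftTwo s α β)).1 _ = 0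
  have e : (fun i => (s α)⁻¹ * (![x, y] : Fin 2 → Γ) i) = ![(s α)⁻¹ * x, (s α)⁻¹ * y] := by
    ext i; fin_cases i <;> rfl
  rw [uModule_section_rep_apply s, e, uDelta_apply, homDelta_one]
  have hξ : ∀ ξ : P, β * ((α * β)⁻¹ * ξ) = α⁻¹ * ξ := fun ξ => by group
  have hξ' : ∀ ξ : P, β⁻¹ * (α⁻¹ * ξ) = (α * β)⁻¹ * ξ := fun ξ => by group
  simp only [liftOne_apply, liftTwo_apply, map_sub, redMap_m₂bar, map_mul, map_inv,
    s.rightHom_section, hξ', obstruction, hξ, Matrix.cons_val_zero]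
  have e2 := conjAct_coord_inv_mul s α x y
  rw [map_mul, map_inv] at e2
  rw [e2]
  have hx := factorSet_mul s α β ((α * β)⁻¹ * S.rightHom x)
  have hy := factorSet_mul s α β ((α * β)⁻¹ * S.rightHom y)
  rw [hξ] at hx hy
  generalize S.conjAct (s α) (factorSet s β ((α * β)⁻¹ * S.rightHom x)) = p₁ at *
  generalize S.conjAct (s α) (factorSet s β ((α * β)⁻¹ * S.rightHom y)) = q₁ at *
  generalize factorSet s α (α⁻¹ * S.rightHom x) = p₂ at *
  generalize factorSet s α (α⁻¹ * S.rightHom y) = q₂ at *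
  generalize factorSet s (α * β) ((α * β)⁻¹ * S.rightHom x) = p₃ at *
  generalize factorSet s (α * β) ((α * β)⁻¹ * S.rightHom y) = q₃ at *
  generalize factorSet s α β = t at *
  generalize (coord s x)⁻¹ * coord s y = g at *
  -- The two routes differ by conjugation with t = f(α, β), and the swap identity absorbs this.
  have h0 := m₂bar_conj_swap t (p₃ * g * q₃⁻¹)
  have h1 := m₂bar_cocycle p₁ p₂ g
  have h2 := m₂bar_cocycle t p₃ g
  have h3 := m₂bar_cocycle p₁ (p₂ * g * q₂⁻¹) q₂
  have h4 := m₂bar_cocycle (p₁ * (p₂ * g * q₂⁻¹) * q₁⁻¹) q₁ q₂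
  have h5 := m₂bar_cocycle t (p₃ * g * q₃⁻¹) q₃
  have h6 := m₂bar_cocycle (t * (p₃ * g * q₃⁻¹) * t⁻¹) t q₃
  have e3 : p₁ * (p₂ * g * q₂⁻¹) * q₁⁻¹ = t * (p₃ * g * q₃⁻¹) * t⁻¹ := by
    have : p₁ * (p₂ * g * q₂⁻¹) * q₁⁻¹ = p₁ * p₂ * g * (q₁ * q₂)⁻¹ := by group
    rw [this, hx, hy]
    group
  rw [hx] at h1
  rw [inv_mul_cancel_right] at h3 h4 h5 h6
  rw [hy] at h4
  rw [e3] at h4 ⊢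
  linear_combination (norm := module) h1 - h2 - h3 + h4 + h5 - h6 + h0

/-- The cocycle identity of the obstruction at (α, β, δ, ε), with ε = (αβδ)⁻¹σ(x): the one term
without ε is the constant on the right. -/
theorem rep_liftTwo (s : S.Section) (α β δ : P) :
    (uModule S (redModule (outerAction S)) 0).rep α (liftTwo s β δ) - liftTwo s (α * β) δ +
      liftTwo s α (β * δ) - liftTwo s α β = constU S (RedH2 G) (obstruction s α β δ) := by
  ext x
  change ((uModule S (redModule (outerAction S)) 0).rep α (liftTwo s β δ)).1 x -
    (liftTwo s (α * β) δ).1 x + (liftTwo s α (β * δ)).1 x - (liftTwo s α β).1 x =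
      obstruction s α β δ
  rw [uModule_section_rep_apply s]
  simp only [liftTwo_apply, map_mul, map_inv, s.rightHom_section, map_neg]
  have h := obstruction_cocycle s α β δ ((α * β * δ)⁻¹ * S.rightHom (x 0))
  have e1 : (β * δ)⁻¹ * (α⁻¹ * S.rightHom (x 0)) = (α * β * δ)⁻¹ * S.rightHom (x 0) := by group
  have e2 : (α * β)⁻¹ * S.rightHom (x 0) = δ * ((α * β * δ)⁻¹ * S.rightHom (x 0)) := by group
  rw [e1, e2, ← mul_assoc α β δ]
  linear_combination (norm := module) (-1 : ℝ) • h

/-- An element of the total complex which represents `g₂` in `E₃^{0,2}`. -/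
noncomputable def lift (s : S.Section) : ∀ p q, HSK S (RedH2 G) p q :=
  DoubleComplex.ofDegreeTwo
    (Bdd.mk (fun _ => extU s 2 (m₂Cochain G)) ⟨_, fun _ => le_rfl⟩)
    (Bdd.mk (fun a => liftOne s (a 0)) ⟨_, fun _ => norm_liftOne_le _ _⟩)
    (Bdd.mk (fun a => liftTwo s (a 0) (a 1)) ⟨_, fun _ => norm_liftTwo_le _ _ _⟩)

theorem lift_mem_Z (s : S.Section) : lift s ∈ (hs S (redModule (outerAction S))).Z 3 0 2 := by
  refine (hsDouble S _).mem_Z_three_zero_two_iff.2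
    ⟨(hsDouble S _).ofDegreeTwo_mem_gr _ _ _, ?_, ?_, ?_⟩
  · refine lp.ext (funext fun _ => ?_)
    change uDelta S _ 2 (extU s 2 (m₂Cochain G)) = 0
    rw [uDelta_extU, LinearMap.mem_ker.1 (m₂Cochain_mem G)]
    rfl
  · refine lp.ext (funext fun a => (d_zero_apply _ _ a).trans ?_)
    exact (uDelta_liftOne s (a 0)).symm
  · refine lp.ext (funext fun a => ?_)
    obtain ⟨α, β, rfl⟩ : ∃ α β, a = ![α, β] := ⟨a 0, a 1, by ext i; fin_cases i <;> rfl⟩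
    have h := d_one_apply (uModule S (redModule (outerAction S)) 1)
      (Bdd.mk (fun a => liftOne s (a 0)) ⟨_, fun _ => norm_liftOne_le _ _⟩) α β
    exact (congrArg (· + uDelta S (RedH2 G) 0 (liftTwo s α β)) h).trans (rep_liftOne s α β)

/-- Since the lift is in Z₃^{0,2}, its differential has only a (3,0)-component, which is the
Π-coboundary of `liftTwo`. -/
theorem D_lift (s : S.Section) : (hs S (redModule (outerAction S))).D (lift s) =
    inflTot S 3 (thetaCochain (fun α => S.conjAct (s α)) (factorSet s)) := by
  refine ((hsDouble S _).eq_edge_of_mem_FK (p := 3) (lift_mem_Z s).2).trans ?_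
  refine congrArg (DoubleComplex.edge 3) ?_
  refine ((hsDouble S (redModule (outerAction S))).totD_succ_zero (lift s) 2).trans ?_
  refine lp.ext (funext fun a => ?_)
  obtain ⟨α, β, δ, rfl⟩ : ∃ α β δ, a = ![α, β, δ] :=
    ⟨a 0, a 1, a 2, by ext i; fin_cases i <;> rfl⟩
  refine (d_two_apply _ _ α β δ).trans ?_
  exact rep_liftTwo s α β δ

/-- Conjugation invariance of m̄₂ makes a normalised section unnecessary here. -/
theorem resTot_lift (s : S.Section) : resTot S (lift s) = m₂Cochain G := by
  change resU S 2 (extU s 2 (m₂Cochain G)) = _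
  ext g
  rw [resU_extU_apply]
  have := m₂bar_conj (coord s 1)⁻¹ (g 0) (g 1)
  rwa [inv_inv] at this

end lift

/-! ### Abstract kernels of the outer action -/

section abstractKernel

variable {G Γ P : Type*} [Group G] [Group Γ] [Group P] {S : GroupExtension G Γ P}

/-- Any preimage of α in Γ induces ψ up to an inner automorphism; right multiplication by an element
of G corrects it. -/
theorem exists_conjAct_eq {α : P} {ψ : MulAut G} (h : Out.mk G ψ = outerAction S α) :
    ∃ γ, S.rightHom γ = α ∧ S.conjAct γ = ψ := by
  obtain ⟨γ, rfl⟩ := S.rightHom_surjective α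
  rw [outerAction_rightHom] at h
  obtain ⟨t, ht⟩ := QuotientGroup.eq.1 h.symm
  refine ⟨γ * S.inl t, by simp, ?_⟩
  rw [map_mul, conjAct_inl, ht, mul_inv_cancel_left]

theorem isAbstractKernel_factorSet (s : S.Section) :
    IsAbstractKernel (outerAction S) (fun α => S.conjAct (s α)) (factorSet s) := by
  refine ⟨fun α => ?_, fun α β => ?_⟩
  · rw [← outerAction_rightHom, s.rightHom_section]
  · ext g
    exact conjAct_conjAct s α β g

/-- The automorphisms of an abstract kernel of the outer action are given by conjugation with a
section of the extension. -/
theorem IsAbstractKernel.exists_section {Ψ : P → MulAut G} {f : P → P → G}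
    (h : IsAbstractKernel (outerAction S) Ψ f) :
    ∃ s : S.Section, Ψ = fun α => S.conjAct (s α) := by
  choose s hs hΨ using fun α => exists_conjAct_eq (h.1 α)
  exact ⟨⟨s, hs⟩, funext fun α => (hΨ α).symm⟩

/-- Since Ψ is the same, f(α, β) and f'(α, β) induce the same inner automorphism, and m̄₂ does not
see the difference. The cochains agree, not only their classes. -/
theorem IsAbstractKernel.thetaCochain_eq {θ : P →* Out G} {Ψ : P → MulAut G} {f f' : P → P → G}
    (h : IsAbstractKernel θ Ψ f) (h' : IsAbstractKernel θ Ψ f') :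
    thetaCochain Ψ f = thetaCochain Ψ f' := by
  have hf : ∀ α β, MulAut.conj (f α β) = MulAut.conj (f' α β) := fun α β =>
    mul_right_cancel ((h.2 α β).symm.trans (h'.2 α β))
  have hΨ : ∀ (ψ : MulAut G) {a b : G}, MulAut.conj a = MulAut.conj b →
      MulAut.conj (ψ a) = MulAut.conj (ψ b) := fun ψ a b hab => by
    have key : ∀ a, MulAut.conj (ψ a) = ψ * MulAut.conj a * ψ⁻¹ := fun a => by ext x; simp
    rw [key, key, hab]
  ext a
  exact congrArg₂ (· - ·) (m₂bar_congr (hΨ _ (hf _ _)) (hf _ _)) (m₂bar_congr (hf _ _) (hf _ _))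

/-- For every abstract kernel, `thetaCochain` is a cocycle, and its class is the image under `d₃` of
every element of `E₃^{0,2}` which restricts to `g₂`. -/
theorem IsAbstractKernel.d₃_eq {Ψ : P → MulAut G} {f : P → P → G}
    (h : IsAbstractKernel (outerAction S) Ψ f) :
    ∃ hc : thetaCochain Ψ f ∈ cocycles (redModule (outerAction S)) 3,
      ∃ x : (hs S (redModule (outerAction S))).E 3 0 2,
        res S (redModule (outerAction S)) x = g₂ G ∧
        d₃ S (redModule (outerAction S)) x =
          infl S (redModule (outerAction S))
            (HB.mk (redModule (outerAction S)) 3 (thetaCochain Ψ f) hc) := by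
  obtain ⟨s, rfl⟩ := h.exists_section
  have hD := (D_lift s).trans
    (congrArg (inflTot S 3) ((isAbstractKernel_factorSet s).thetaCochain_eq h))
  -- The cocycle property comes from D² = 0, as the inflation of the cochain is a total coboundary
  -- and constants embed into U⁰.
  have hc : thetaCochain (fun α => S.conjAct (s α)) f ∈ cocycles (redModule (outerAction S)) 3 := by
    have h0 := D_inflTot S (redModule (outerAction S)) 3
      (thetaCochain (fun α => S.conjAct (s α)) f)
    rw [← hD, (hs S _).D_D] at h0
    have h1 := congrArg (fun y => y 4 0) h0
    refine LinearMap.mem_ker.2 (lp.ext (funext fun a => constU_injective (S := S) ?_))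
    have h2 : Bdd.map (constU S (RedH2 G)) (d (redModule (outerAction S)) 3
        (thetaCochain (fun α => S.conjAct (s α)) f)) = 0 :=
      (DoubleComplex.edge_zero (K := HSK S (RedH2 G)) 4 _).symm.trans h1.symm
    exact congrArg (fun y => y.1 a) h2
  refine ⟨hc, Submodule.Quotient.mk ⟨lift s, lift_mem_Z s⟩, ?_, ?_⟩
  · rw [res_mk]
    refine HB.mk_eq_iff.2 ?_
    rw [resTot_lift, sub_self]
    exact zero_mem _
  · exact congrArg Submodule.Quotient.mk (Subtype.ext hD)

end abstractKernel
end BddCoh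
-- The theorem
open BddCoh in
theorem mainTheorem5 {G Γ P : Type*} [Group G] [Group Γ] [Group P] (S : GroupExtension G Γ P) :
    -- restriction to `G` identifies `E₃^{0,2}` with `H_b²(G, H̄₂(G))^P`
    Function.Injective (res S (redModule (outerAction S))) ∧
    LinearMap.range (res S (redModule (outerAction S))) =
      invariants S (redModule (outerAction S)) ∧
    -- inflation identifies `H_b³(P, H̄₂(G))` with `E₃^{3,0}`
    Function.Bijective (infl S (redModule (outerAction S))) ∧
    -- `g₂` is invariant, hence it is an element of `E₃^{0,2}`
    g₂ G ∈ invariants S (redModule (outerAction S)) ∧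
    -- the class `[θ]`, represented by all abstract kernels of the outer action, is `d₃(g₂)`
    (∃ (Ψ : P → MulAut G) (f : P → P → G), IsAbstractKernel (outerAction S) Ψ f) ∧
    ∃ c : HB (redModule (outerAction S)) 3,
      (∀ (Ψ : P → MulAut G) (f : P → P → G), IsAbstractKernel (outerAction S) Ψ f →
        ∃ h : thetaCochain Ψ f ∈ cocycles (redModule (outerAction S)) 3,
          HB.mk (redModule (outerAction S)) 3 (thetaCochain Ψ f) h = c) ∧
      ∃ x : (hs S (redModule (outerAction S))).E 3 0 2,
        res S (redModule (outerAction S)) x = g₂ G ∧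
        d₃ S (redModule (outerAction S)) x =
          infl S (redModule (outerAction S)) c := by
  obtain ⟨s, -⟩ := exists_section_map_one S
  obtain ⟨h, x, hx, hd⟩ := (isAbstractKernel_factorSet s).d₃_eq
  refine ⟨res_injective S _, range_res S _, ⟨infl_injective S _, infl_surjective S _⟩, ?_,
    ⟨_, _, isAbstractKernel_factorSet s⟩, _, fun Ψ f hΨ => ?_, x, hx, hd⟩
  · rw [← range_res]
    exact ⟨x, hx⟩
  · obtain ⟨h', x', hx', hd'⟩ := hΨ.d₃_eq
    -- Both classes inflate to d₃ of an element restricting to g₂, and injectivity of `res` makes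
    -- that element unique.
    refine ⟨h', infl_injective S _ ?_⟩
    rw [← hd', ← hd, res_injective S _ (hx'.trans hx.symm)]
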